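/- **Setting.** Let $s_0,\dots,s_{M-1}\in\mathbb C$ be the distinct, equiprobable points of a constellation (e.g. $M$-QAM) with $\frac1M\sum_j|s_j|^2=1$, sent over $y=\sqrt\gamma\,s+z$ with $z\sim\mathcal{CN}(0,1)$. Let $$\mathcal I_M(\gamma)=\log_2\frac{M}{e}-\frac1{M\pi}\sum_j\int_{\mathbb C}e^{-|u-\sqrt\gamma s_j|^2}\log_2\Big(\sum_k e^{-|u-\sqrt\gamma s_k|^2}\Big)du$$ be the mutual information in bits, and $\mathsf{MMSE}_M(\gamma)=\mathbb E|s-\mathbb E[s\mid y]|^2$. Let $0<R_s<\log_2M$. A mixture Gamma law with $L$ components has density $f(x)=\sum_{l=1}^{L}\alpha_lx^{\beta_l-1}e^{-\zeta_lx}$ on $x\ge 0$, where $\alpha_l\ge0$, $\beta_l,\zeta_l>0$ and $\sum_l\alpha_l\Gamma(\beta_l)\zeta_l^{-\beta_l}=1$; its distribution function is $F(x)=\sum_l\alpha_l\zeta_l^{-\beta_l}\Upsilon(\beta_l,\zeta_lx)$ with $\Upsilon(a,\rho)=\int_0^\rho t^{a-1}e^{-t}dt$. The eavesdropper's SNR $\gamma_E$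 has a fixed mixture Gamma law ($f_E$, $F_E$). The main-channel SNR $\gamma_B$ is independent of $\gamma_E$ and has a mixture Gamma law with $L_B$ components, whose parameters $\alpha_{B,l},\beta_{B,l},\zeta_{B,l}$ may depend on $\bar\gamma_B>0$ (in the model, the average main-channel SNR; the equality $\mathbb E\gamma_B=\bar\gamma_B$ is not needed). Assume that $\zeta_{B,l}\to0$ as $\bar\gamma_B\to\infty$, and that there are constants $\Phi_{B,l}>0$, $\Lambda_{B,l}>0$ and $0<\Psi_{B,1}\le\dots\le\Psi_{B,L_B}$ with $$\sum_{l=1}^{L_B}\frac{\alpha_{B,l}}{\beta_{B,l}}x^{\beta_{B,l}}=\sum_{l=1}^{L_B}\Phi_{B,l}\,x^{\Lambda_{B,l}}\,\bar\gamma_B^{-\Psi_{B,l}}\qquad\text{for all }x>0,\ \bar\gamma_B>0.$$ The secrecy outage probability is $P(R_s)=\Pr\big(\max\{\mathcal I_M(\gamma_B)-\mathcal I_M(\gamma_E),0\}<R_s\big)$. **Theorem.** The function $\mathcal I_M$ is strictly increasing and maps $[0,\infty)$ bijectively onto $[0,\log_2M)$. With $\mathcal I_M^{-1}$ its inverse,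 put $\mathcal H_M=\mathcal I_M^{-1}(\log_2M-R_s)$, $\mathcal F_M(y)=\mathcal I_M^{-1}(R_s+\mathcal I_M(y))$, $\mathcal Z_M(x)=\mathcal I_M^{-1}(\mathcal I_M(x)-R_s)$ and $$\Delta_{M,l}=\int_0^{\mathcal H_M}\mathcal F_M(y)^{\Lambda_{B,l}}f_E(y)\,dy .$$ Let $\mathcal K_M(x)=0$ for $0<x\le\mathcal I_M^{-1}(R_s)$, and $\mathcal K_M(x)=f_E(\mathcal Z_M(x))\,\mathsf{MMSE}_M(x)/\mathsf{MMSE}_M(\mathcal Z_M(x))$ for $x>\mathcal I_M^{-1}(R_s)$. Then: 1. For every $l$ the Mellin transform of $\mathcal K_M$ at $\Lambda_{B,l}+1$ converges absolutely, $\Delta_{M,l}=\int_0^\infty x^{\Lambda_{B,l}}\mathcal K_M(x)\,dx$, and $0<\Delta_{M,l}<\infty$. 2. $G'_{a,B,M}:=\sum_{l:\,\Psi_{B,l}=\Psi_{B,1}}\Delta_{M,l}\Phi_{B,l}>0$, and with $G_{d,B}:=\Psi_{B,1}>0$, as $\bar\gamma_B\to\infty$, $$P(R_s)=1-F_E(\mathcal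 H_M)+G'_{a,B,M}\,\bar\gamma_B^{-G_{d,B}}+o\big(\bar\gamma_B^{-G_{d,B}}\big).$$ 3. Consequently $P(R_s)\to1-F_E(\mathcal H_M)>0$, with secrecy diversity order $$-\lim_{\bar\gamma_B\to\infty}\frac{\log\big(P(R_s)-(1-F_E(\mathcal H_M))\big)}{\log\bar\gamma_B}=G_{d,B}.$$ -/

import Mathlib

open Filter Asymptotics
open scoped Topology

namespace MGSecrecy

noncomputable section

/-- A complex constellation of `M` distinct, equiprobable symbols with unit average energy. -/
structure Constellation (M : ℕ) where
  /-- the symbols -/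
  sym : Fin M → ℂ
  injective : Function.Injective sym
  unit_energy : (1 / (M : ℝ)) * ∑ j, ‖sym j‖ ^ 2 = 1

variable {M L : ℕ}

/-- The kernel `exp (-|u - √γ s_j|²)`; divided by `π` it is the density of the received signal
`√γ s_j + z` with `z` standard complex Gaussian. -/
def Constellation.kernel (S : Constellation M) (γ : ℝ) (j : Fin M) (u : ℂ) : ℝ :=
  Real.exp (-‖u - (Real.sqrt γ : ℂ) * S.sym j‖ ^ 2)

/-- The function `𝓛_M`. -/
def Constellation.ell (S : Constellation M) (γ : ℝ) : ℝ :=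
  (1 / ((M : ℝ) * Real.pi)) * ∑ j, ∫ u : ℂ,
    S.kernel γ j u * Real.logb 2 (∑ k, S.kernel γ k u)

/-- The mutual information (in bits) at signal-to-noise ratio `γ`. -/
def Constellation.info (S : Constellation M) (γ : ℝ) : ℝ :=
  Real.logb 2 ((M : ℝ) / Real.exp 1) - S.ell γ

/-- The inverse of the mutual information, as a function on `[0, ∞)`. -/
def Constellation.infoInv (S : Constellation M) (r : ℝ) : ℝ :=
  Function.invFunOn S.info (Set.Ici 0) r

/-- The conditional mean of the symbol given that `u` is received. -/
def Constellation.condMean (S : Constellation M) (γ : ℝ) (u : ℂ) : ℂ :=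
  (∑ k, (S.kernel γ k u : ℂ) * S.sym k) / (∑ k, (S.kernel γ k u : ℂ))

/-- The minimum mean square error `𝔼 |s - 𝔼[s | √γ s + z]|²`. -/
def Constellation.mmse (S : Constellation M) (γ : ℝ) : ℝ :=
  (1 / ((M : ℝ) * Real.pi)) * ∑ j, ∫ u : ℂ,
    S.kernel γ j u * ‖S.sym j - S.condMean γ u‖ ^ 2

/-- The lower incomplete Gamma function. -/
def lowerGamma (a ρ : ℝ) : ℝ :=
  ∫ t in (0 : ℝ)..ρ, t ^ (a - 1) * Real.exp (-t)

/-- The parameters of a mixture Gamma distribution with `L` components: nonnegative mixture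
coefficients, positive shapes and rates, total mass one. -/
structure MixtureGamma (L : ℕ) where
  α : Fin L → ℝ
  β : Fin L → ℝ
  ζ : Fin L → ℝ
  α_nonneg : ∀ l, 0 ≤ α l
  β_pos : ∀ l, 0 < β l
  ζ_pos : ∀ l, 0 < ζ l
  total : ∑ l, α l * Real.Gamma (β l) * (ζ l) ^ (-(β l)) = 1

/-- The density on `[0, ∞)`. -/
def MixtureGamma.pdf (D : MixtureGamma L) (x : ℝ) : ℝ :=
  ∑ l, D.α l * x ^ (D.β l - 1) * Real.exp (-(D.ζ l * x))

/-- The distribution function on `[0, ∞)`. -/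
def MixtureGamma.cdf (D : MixtureGamma L) (x : ℝ) : ℝ :=
  ∑ l, D.α l * (D.ζ l) ^ (-(D.β l)) * lowerGamma (D.β l) (D.ζ l * x)

/-- The law on the real line. -/
def MixtureGamma.law (D : MixtureGamma L) : MeasureTheory.Measure ℝ :=
  (MeasureTheory.volume.restrict (Set.Ici (0 : ℝ))).withDensity
    (fun x => ENNReal.ofReal (D.pdf x))

/-- The instantaneous secrecy rate at main-channel SNR `x` and eavesdropper SNR `y`. -/
def secrecyRate (S : Constellation M) (x y : ℝ) : ℝ :=
  max (S.info x - S.info y) 0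

/-- The secrecy outage probability for independent SNRs with laws `B` (main channel) and `E`
(eavesdropper): the probability that the secrecy rate is less than `R`. -/
def sop {LB LE : ℕ} (S : Constellation M) (B : MixtureGamma LB) (E : MixtureGamma LE)
    (R : ℝ) : ℝ :=
  ((B.law.prod E.law) {p : ℝ × ℝ | secrecyRate S p.1 p.2 < R}).toReal

/-- `𝓗_M`. -/
def snrH (S : Constellation M) (R : ℝ) : ℝ :=
  S.infoInv (Real.logb 2 (M : ℝ) - R)

/-- `𝓕_M`. -/
def snrF (S : Constellation M) (R y : ℝ) : ℝ :=
  S.infoInv (R + S.info y)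

/-- `𝓩_M`. -/
def snrZ (S : Constellation M) (R x : ℝ) : ℝ :=
  S.infoInv (S.info x - R)

/-- `𝓦_M`. -/
def funW (S : Constellation M) (E : MixtureGamma L) (R x : ℝ) : ℝ :=
  E.pdf (snrZ S R x) * S.mmse x / S.mmse (snrZ S R x)

/-- `𝓚_M`: it vanishes up to the SNR at which the mutual information equals `R`. -/
def funK (S : Constellation M) (E : MixtureGamma L) (R x : ℝ) : ℝ :=
  if x ≤ S.infoInv R then 0 else funW S E R x

/-- The coefficient `Δ_M` belonging to the exponent `lam`. -/
def coeffDelta (S : Constellation M) (E : MixtureGamma L) (R lam : ℝ) : ℝ :=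
  ∫ y in Set.Ioo 0 (snrH S R), (snrF S R y) ^ lam * E.pdf y

/-- The coefficient `G'_a`: the sum of `Δ_l Φ_l` over the indices `l` with `Ψ_l` equal to the
first `Ψ`. -/
def coeffG {LB : ℕ} [NeZero LB] (S : Constellation M) (E : MixtureGamma L) (R : ℝ)
    (Φ Λ Ψ : Fin LB → ℝ) : ℝ :=
  ∑ l ∈ Finset.univ.filter (fun l => Ψ l = Ψ 0), coeffDelta S E R (Λ l) * Φ l

end

end MGSecrecy

open MGSecrecy

/-! Condition on the eavesdropper SNR `y`. The mutual information `I` increases strictly to `log₂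
M`, which it never attains. Hence outage is certain when `y ≥ H = snrH`, and for `y < H` it means
that the main-channel SNR is below `F(y) = snrF`. So the outage probability is `∫₀ᴴ F_B(F(y)) f_E(y)
dy + 1 - F_E(H)`, and only the integral depends on the average SNR `g`. Dropping the exponentials
from the main-channel density bounds `F_B(x)` above by `∑ Φ_l x^Λ_l g^(-Ψ_l)`; the error is a factor
at least `exp (-(∑ ζ_l) x)`, which tends to 1. After multiplication by `g^Ψ_0` the integrand
therefore converges pointwise, and for `g ≥ 1` it is dominated by `∑ Φ_l F(y)^Λ_l f_E(y)`. Dominated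
convergence gives the expansion, from which the limit and the diversity order follow.

The delicate point is the integrability of this dominating function, since `F(y) → ∞` as `y → H`.
The gap `log₂ M - I(x)` is at most `C exp (-κ x)` (`exists_sub_info_le`), while `I(H) - I(y)` is at
least `c (H - y)` (`exists_mul_le_info_sub`). Hence `F` grows at most logarithmically in `1 / (H -
y)`, and each of its powers is `O((H - y)^(-1/2))` (`exists_snrF_rpow_le`).

Monotonicity and the Mellin form both rest on the relation `I' = MMSE / log 2`. Recentred at the
transmitted symbol, `I` becomes an average of Gaussian integrals of log-partition functions in the
amplitude `a = √γ`. Differentiation under the integral and Gaussian integration by parts turn the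
derivative into the mean square of the posterior mean displacement (`hasDerivAt_logPartition`),
which is the estimation error. The substitution `y = snrZ x` then has Jacobian `MMSE(x) / MMSE(snrZ
x)`, which identifies the coefficient with the Mellin transform (`hasMellin_funK`). -/

namespace MGSecrecy

noncomputable section

open MeasureTheory

/-! ### Log-partition functions under a complex Gaussian weight -/

/-- The unnormalized posterior weight of the displacement `d k`. -/
def tilt {ι : Type*} (d : ι → ℂ) (a : ℝ) (z : ℂ) (k : ι) : ℝ :=
  Real.exp (-2 * a * inner ℝ z (d k) - a ^ 2 * ‖d k‖ ^ 2)

/-- The partition function of the weights `tilt`. -/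
def partition {ι : Type*} [Fintype ι] (d : ι → ℂ) (a : ℝ) (z : ℂ) : ℝ :=
  ∑ k, tilt d a z k

/-- The posterior probability of the displacement `d k`. -/
def posterior {ι : Type*} [Fintype ι] (d : ι → ℂ) (a : ℝ) (z : ℂ) (k : ι) : ℝ :=
  tilt d a z k / partition d a z

/-- The posterior mean displacement. -/
def postMean {ι : Type*} [Fintype ι] (d : ι → ℂ) (a : ℝ) (z : ℂ) : ℂ :=
  ∑ k, posterior d a z k • d k

/-- The Gaussian integral of the log-partition function. -/
def logPartition {ι : Type*} [Fintype ι] (d : ι → ℂ) (a : ℝ) : ℝ :=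
  ∫ z : ℂ, Real.exp (-‖z‖ ^ 2) * Real.log (partition d a z)

theorem integral_gaussian : ∫ z : ℂ, Real.exp (-‖z‖ ^ 2) = Real.pi := by
  have h := Complex.integral_exp_neg_rpow (p := 2) (by norm_num)
  norm_num at h
  simpa using h

theorem integral_norm_sq_mul_gaussian :
    ∫ z : ℂ, ‖z‖ ^ 2 * Real.exp (-‖z‖ ^ 2) = Real.pi := by
  have h := Complex.integral_rpow_mul_exp_neg_rpow (p := 2) (q := 2) (by norm_num) (by norm_num)
  norm_num at h
  simpa using h

/-- The Bochner integral of a non-integrable function is 0 by convention, so a nonzero value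
certifies integrability. -/
theorem integrable_gaussian : Integrable (fun z : ℂ => Real.exp (-‖z‖ ^ 2)) :=
  .of_integral_ne_zero (by rw [integral_gaussian]; exact Real.pi_ne_zero)

theorem integrable_norm_sq_mul_gaussian :
    Integrable (fun z : ℂ => ‖z‖ ^ 2 * Real.exp (-‖z‖ ^ 2)) :=
  .of_integral_ne_zero (by rw [integral_norm_sq_mul_gaussian]; exact Real.pi_ne_zero)

theorem integrable_gaussian_mul_affine (A B : ℝ) :
    Integrable (fun z : ℂ => Real.exp (-‖z‖ ^ 2) * (A * ‖z‖ + B)) := by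
  have h : Integrable (fun z : ℂ => |A| * (‖z‖ ^ 2 * Real.exp (-‖z‖ ^ 2))
      + (|A| + |B|) * Real.exp (-‖z‖ ^ 2)) :=
    (integrable_norm_sq_mul_gaussian.const_mul _).add (integrable_gaussian.const_mul _)
  refine h.mono' (by fun_prop) (ae_of_all _ fun z => ?_)
  rw [norm_mul, Real.norm_of_nonneg (Real.exp_pos _).le]
  have h1 : ‖A * ‖z‖ + B‖ ≤ |A| * ‖z‖ + |B| := by
    refine (norm_add_le _ _).trans ?_
    simp
  have h2 : ‖z‖ ≤ ‖z‖ ^ 2 + 1 := by nlinarith [sq_nonneg (‖z‖ - 1), norm_nonneg z]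
  have h3 : |A| * ‖z‖ ≤ |A| * (‖z‖ ^ 2 + 1) := mul_le_mul_of_nonneg_left h2 (abs_nonneg A)
  calc Real.exp (-‖z‖ ^ 2) * ‖A * ‖z‖ + B‖
      ≤ Real.exp (-‖z‖ ^ 2) * (|A| * (‖z‖ ^ 2 + 1) + |B|) :=
        mul_le_mul_of_nonneg_left (by linarith) (Real.exp_pos _).le
    _ = _ := by ring

/-- Linear growth suffices as a criterion: log-partition functions grow at most linearly, and
posterior probabilities and means are bounded. -/
theorem integrable_gaussian_mul_of_bound {f : ℂ → ℝ} (hf : Continuous f) (A B : ℝ)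
    (h : ∀ z, |f z| ≤ A * ‖z‖ + B) :
    Integrable (fun z : ℂ => Real.exp (-‖z‖ ^ 2) * f z) := by
  refine (integrable_gaussian_mul_affine A B).mono' (by fun_prop) (ae_of_all _ fun z => ?_)
  rw [norm_mul, Real.norm_of_nonneg (Real.exp_pos _).le]
  exact mul_le_mul_of_nonneg_left (h z) (Real.exp_pos _).le

/-! ### Gaussian integrals of a single tilt -/

section Partition

variable {ι : Type*} (d : ι → ℂ) (a : ℝ) (z : ℂ)

theorem tilt_pos (k : ι) : 0 < tilt d a z k := Real.exp_pos _

@[fun_prop]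
theorem continuous_tilt (k : ι) : Continuous (fun z => tilt d a z k) := by
  unfold tilt; fun_prop

theorem hasDerivAt_tilt (k : ι) :
    HasDerivAt (fun a => tilt d a z k)
      (tilt d a z k * (-2 * inner ℝ z (d k) - 2 * a * ‖d k‖ ^ 2)) a := by
  have h : HasDerivAt (fun a : ℝ => -2 * a * inner ℝ z (d k) - a ^ 2 * ‖d k‖ ^ 2)
      (-2 * inner ℝ z (d k) - 2 * a * ‖d k‖ ^ 2) a := by
    have h1 := ((hasDerivAt_id a).const_mul (-2)).mul_const (inner ℝ z (d k))
    have h2 := (hasDerivAt_pow 2 a).mul_const (‖d k‖ ^ 2)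
    refine (h1.sub h2).congr_deriv ?_
    simp
  exact h.exp

theorem hasFDerivAt_tilt (k : ι) :
    HasFDerivAt (fun z => tilt d a z k) ((-2 * a * tilt d a z k) • innerSL ℝ (d k)) z := by
  have h : HasFDerivAt (fun z : ℂ => -2 * a * inner ℝ z (d k) - a ^ 2 * ‖d k‖ ^ 2)
      ((-2 * a) • innerSL ℝ (d k)) z := by
    have h1 := ((innerSL ℝ (d k)).hasFDerivAt (x := z)).const_mul (-2 * a)
    refine (h1.sub_const (a ^ 2 * ‖d k‖ ^ 2)).congr_of_eventuallyEq
      (Eventually.of_forall fun w => ?_)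
    simp [real_inner_comm]
  refine h.exp.congr_fderiv ?_
  rw [smul_smul, tilt]; ring_nf

theorem hasFDerivAt_gaussian (z : ℂ) :
    HasFDerivAt (fun z : ℂ => Real.exp (-‖z‖ ^ 2))
      ((-2 * Real.exp (-‖z‖ ^ 2)) • innerSL ℝ z) z := by
  refine ((hasStrictFDerivAt_norm_sq z).hasFDerivAt.fun_neg).exp.congr_fderiv ?_
  ext v
  simp [-Complex.inner]
  ring

/-- Completing the square: tilting the Gaussian weight amounts to translating it. -/
theorem gaussian_mul_tilt (k : ι) :
    Real.exp (-‖z‖ ^ 2) * tilt d a z k = Real.exp (-‖z + (a : ℂ) * d k‖ ^ 2) := by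
  rw [tilt, ← Real.exp_add]
  congr 1
  have h : (a : ℂ) * d k = a • d k := by simp
  rw [h, norm_add_sq_real, norm_smul, real_inner_smul_right, mul_pow, Real.norm_eq_abs, sq_abs]
  ring

/-- The bound `log (1 + x) ≤ x` would be useless here: the Gaussian integral of a tilt is `π` for
every `a`, whereas that of its square root decays in `a` when the displacement is nonzero. -/
theorem log_one_add_le_sqrt {x : ℝ} (hx : 0 ≤ x) : Real.log (1 + x) ≤ √x := by
  have h1 : 1 + x ≤ Real.exp (√x) ^ 1 := by
    have hs := Real.sqrt_nonneg x
    have h2 : √x ^ 2 = x := Real.sq_sqrt hx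
    have h3 := Real.sum_le_exp_of_nonneg hs 4
    simp only [Finset.sum_range_succ, Finset.sum_range_zero, Nat.factorial] at h3
    norm_num at h3
    rw [pow_one]
    -- With `s = √x`, the cubic Taylor polynomial of `exp s` exceeds `1 + s ^ 2` by `s * ((s - 3/2)
    -- ^ 2 + 15/4) / 6`.
    nlinarith [mul_nonneg hs (sq_nonneg (√x - 3 / 2))]
  have h := Real.log_le_log (by positivity) h1
  simpa using h

/-- The root halves the exponent. Completing the square with amplitude `a / 2` uses a quarter of `a
^ 2 * ‖d k‖ ^ 2` out of the available half; the other quarter is the decay. -/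
theorem gaussian_mul_sqrt_tilt (k : ι) :
    Real.exp (-‖z‖ ^ 2) * √(tilt d a z k) =
      Real.exp (-(a ^ 2 * ‖d k‖ ^ 2 / 4)) * Real.exp (-‖z + ((a / 2 : ℝ) : ℂ) * d k‖ ^ 2) := by
  rw [← gaussian_mul_tilt, tilt, tilt, Real.sqrt_eq_rpow, ← Real.exp_mul, ← Real.exp_add,
    ← Real.exp_add, ← Real.exp_add]
  congr 1
  ring

theorem integral_gaussian_mul_sqrt_tilt (k : ι) :
    Integrable (fun z : ℂ => Real.exp (-‖z‖ ^ 2) * √(tilt d a z k)) ∧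
    ∫ z : ℂ, Real.exp (-‖z‖ ^ 2) * √(tilt d a z k) =
      Real.pi * Real.exp (-(a ^ 2 * ‖d k‖ ^ 2 / 4)) := by
  simp only [gaussian_mul_sqrt_tilt]
  refine ⟨(integrable_gaussian.comp_add_right _).const_mul _, ?_⟩
  rw [integral_const_mul,
    integral_add_right_eq_self (fun z : ℂ => Real.exp (-‖z‖ ^ 2)), integral_gaussian, mul_comm]

theorem sqrt_sum_le_sum_sqrt (s : Finset ι) {x : ι → ℝ} (hx : ∀ i ∈ s, 0 ≤ x i) :
    √(∑ i ∈ s, x i) ≤ ∑ i ∈ s, √(x i) := by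
  refine Finset.le_sum_of_subadditive_on_pred Real.sqrt (fun x => 0 ≤ x) Real.sqrt_zero.le ?_
    (fun x y => add_nonneg) x hx
  intro x y hx hy
  rw [Real.sqrt_le_left (by positivity)]
  nlinarith [Real.sq_sqrt hx, Real.sq_sqrt hy, mul_nonneg (Real.sqrt_nonneg x) (Real.sqrt_nonneg y)]

end Partition

section Fintype

variable {ι : Type*} [Fintype ι] (d : ι → ℂ) (a : ℝ) (z : ℂ)

@[fun_prop]
theorem continuous_partition : Continuous (fun z => partition d a z) := by
  unfold partition; fun_prop

theorem norm_le_sum_norm (k : ι) : ‖d k‖ ≤ ∑ i, ‖d i‖ :=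
  Finset.single_le_sum (f := fun i => ‖d i‖) (fun _ _ => norm_nonneg _) (Finset.mem_univ k)

theorem abs_exponent_le (k : ι) :
    |-2 * a * inner ℝ z (d k) - a ^ 2 * ‖d k‖ ^ 2| ≤
      2 * |a| * (∑ i, ‖d i‖) * ‖z‖ + a ^ 2 * (∑ i, ‖d i‖) ^ 2 := by
  have hk := norm_le_sum_norm d k
  have h1 : |inner ℝ z (d k)| ≤ ‖z‖ * ∑ i, ‖d i‖ :=
    (abs_real_inner_le_norm _ _).trans (mul_le_mul_of_nonneg_left hk (norm_nonneg _))
  have h2 : ‖d k‖ ^ 2 ≤ (∑ i, ‖d i‖) ^ 2 := pow_le_pow_left₀ (norm_nonneg _) hk 2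
  refine (abs_sub _ _).trans ?_
  rw [abs_mul, abs_mul, abs_mul, abs_of_nonneg (sq_nonneg a), abs_of_nonneg (sq_nonneg ‖d k‖)]
  have h3 := mul_le_mul_of_nonneg_left h1 (by positivity : 0 ≤ |(-2 : ℝ)| * |a|)
  have h4 := mul_le_mul_of_nonneg_left h2 (sq_nonneg a)
  rw [show |(-2 : ℝ)| = 2 by norm_num] at *
  linarith

/-- A zero displacement has weight 1, so the partition function is at least 1. -/
theorem logPartition_nonneg {j : ι} (hj : d j = 0) : 0 ≤ logPartition d a := by
  refine integral_nonneg fun z => mul_nonneg (Real.exp_pos _).le (Real.log_nonneg ?_)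
  have h : tilt d a z j = 1 := by simp [tilt, hj]
  rw [← h]
  exact Finset.single_le_sum (fun i _ => (tilt_pos d a z i).le) (Finset.mem_univ j)

theorem logPartition_zero : logPartition d 0 = Real.pi * Real.log (Fintype.card ι) := by
  have h : ∀ z, partition d 0 z = Fintype.card ι := fun z => by simp [partition, tilt]
  simp only [logPartition, h]
  rw [integral_mul_const, integral_gaussian]

end Fintype

/-! ### Posterior averages and the derivative of the log-partition integral -/

section Nonempty

variable {ι : Type*} [Fintype ι] [Nonempty ι] (d : ι → ℂ) (a : ℝ) (z : ℂ)

theorem partition_pos : 0 < partition d a z :=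
  Finset.sum_pos (fun k _ => tilt_pos d a z k) Finset.univ_nonempty

theorem posterior_pos (k : ι) : 0 < posterior d a z k :=
  div_pos (tilt_pos d a z k) (partition_pos d a z)

theorem sum_posterior : ∑ k, posterior d a z k = 1 := by
  unfold posterior
  rw [← Finset.sum_div]
  exact div_self (partition_pos d a z).ne'

theorem posterior_le_one (k : ι) : posterior d a z k ≤ 1 := by
  rw [← sum_posterior d a z]
  exact Finset.single_le_sum (fun i _ => (posterior_pos d a z i).le) (Finset.mem_univ k)

@[fun_prop]
theorem continuous_posterior (k : ι) : Continuous (fun z => posterior d a z k) := by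
  unfold posterior
  exact (continuous_tilt d a k).div (continuous_partition d a) fun z => (partition_pos d a z).ne'

@[fun_prop]
theorem continuous_postMean : Continuous (fun z => postMean d a z) := by
  unfold postMean; fun_prop

@[fun_prop]
theorem continuous_log_partition : Continuous (fun z => Real.log (partition d a z)) :=
  (continuous_partition d a).log fun z => (partition_pos d a z).ne'

theorem abs_log_partition_le :
    |Real.log (partition d a z)| ≤ 2 * |a| * (∑ i, ‖d i‖) * ‖z‖ +
      (a ^ 2 * (∑ i, ‖d i‖) ^ 2 + Real.log (Fintype.card ι)) := by
  set c := 2 * |a| * (∑ i, ‖d i‖) * ‖z‖ + a ^ 2 * (∑ i, ‖d i‖) ^ 2 with hc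
  have hcard : (1 : ℝ) ≤ Fintype.card ι := by exact_mod_cast Fintype.card_pos
  have hlog : 0 ≤ Real.log (Fintype.card ι) := Real.log_nonneg hcard
  have hup : Real.log (partition d a z) ≤ Real.log (Fintype.card ι) + c := by
    rw [← Real.log_exp c, ← Real.log_mul (by positivity) (Real.exp_pos _).ne']
    refine Real.log_le_log (partition_pos d a z) ?_
    calc partition d a z ≤ ∑ _k : ι, Real.exp c :=
          Finset.sum_le_sum fun k _ =>
            Real.exp_le_exp.2 ((le_abs_self _).trans (abs_exponent_le d a z k))
      _ = _ := by simp
  have hlow : -c ≤ Real.log (partition d a z) := by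
    obtain ⟨k⟩ := ‹Nonempty ι›
    have h1 : Real.log (tilt d a z k) ≤ Real.log (partition d a z) :=
      Real.log_le_log (tilt_pos d a z k)
        (Finset.single_le_sum (fun i _ => (tilt_pos d a z i).le) (Finset.mem_univ k))
    rw [tilt, Real.log_exp] at h1
    have h2 := (abs_le.1 (abs_exponent_le d a z k)).1
    linarith
  rw [abs_le]
  constructor <;> linarith

theorem integrable_log_partition :
    Integrable (fun z : ℂ => Real.exp (-‖z‖ ^ 2) * Real.log (partition d a z)) :=
  integrable_gaussian_mul_of_bound (continuous_log_partition d a) _ _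
    (abs_log_partition_le d a)

theorem hasDerivAt_log_partition :
    HasDerivAt (fun a => Real.log (partition d a z))
      (∑ k, posterior d a z k * (-2 * inner ℝ z (d k) - 2 * a * ‖d k‖ ^ 2)) a := by
  have h : HasDerivAt (fun a => partition d a z)
      (∑ k, tilt d a z k * (-2 * inner ℝ z (d k) - 2 * a * ‖d k‖ ^ 2)) a := by
    unfold partition
    exact HasDerivAt.fun_sum fun k _ => hasDerivAt_tilt d a z k
  convert h.log (partition_pos d a z).ne' using 1
  rw [Finset.sum_div]
  refine Finset.sum_congr rfl fun k _ => ?_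
  rw [posterior]; ring

theorem abs_deriv_log_partition_le :
    |∑ k, posterior d a z k * (-2 * inner ℝ z (d k) - 2 * a * ‖d k‖ ^ 2)| ≤
      2 * (∑ i, ‖d i‖) * ‖z‖ + 2 * |a| * (∑ i, ‖d i‖) ^ 2 := by
  set D := ∑ i, ‖d i‖
  have key : ∀ k, |-2 * inner ℝ z (d k) - 2 * a * ‖d k‖ ^ 2| ≤ 2 * D * ‖z‖ + 2 * |a| * D ^ 2 := by
    intro k
    have hk := norm_le_sum_norm d k
    have h1 : |inner ℝ z (d k)| ≤ ‖z‖ * D :=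
      (abs_real_inner_le_norm _ _).trans (mul_le_mul_of_nonneg_left hk (norm_nonneg _))
    have h2 : ‖d k‖ ^ 2 ≤ D ^ 2 := pow_le_pow_left₀ (norm_nonneg _) hk 2
    refine (abs_sub _ _).trans ?_
    rw [abs_mul, abs_mul, abs_mul, abs_of_nonneg (sq_nonneg ‖d k‖)]
    have h4 := mul_le_mul_of_nonneg_left h2 (abs_nonneg a)
    rw [show |(-2 : ℝ)| = 2 by norm_num, abs_two]
    linarith
  refine (Finset.abs_sum_le_sum_abs _ _).trans ?_
  calc ∑ k, |posterior d a z k * (-2 * inner ℝ z (d k) - 2 * a * ‖d k‖ ^ 2)|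
      ≤ ∑ k, posterior d a z k * (2 * D * ‖z‖ + 2 * |a| * D ^ 2) := by
        refine Finset.sum_le_sum fun k _ => ?_
        rw [abs_mul, abs_of_pos (posterior_pos d a z k)]
        exact mul_le_mul_of_nonneg_left (key k) (posterior_pos d a z k).le
    _ = _ := by rw [← Finset.sum_mul, sum_posterior, one_mul]

theorem hasDerivAt_logPartition_integral :
    HasDerivAt (logPartition d) (∫ z : ℂ, Real.exp (-‖z‖ ^ 2) *
      ∑ k, posterior d a z k * (-2 * inner ℝ z (d k) - 2 * a * ‖d k‖ ^ 2)) a := by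
  refine (hasDerivAt_integral_of_dominated_loc_of_deriv_le (μ := volume)
    (F := fun a z => Real.exp (-‖z‖ ^ 2) * Real.log (partition d a z))
    (F' := fun a z => Real.exp (-‖z‖ ^ 2) *
      ∑ k, posterior d a z k * (-2 * inner ℝ z (d k) - 2 * a * ‖d k‖ ^ 2))
    -- For `b` in the unit ball around `a`, `|b| ≤ |a| + 1` makes the derivative bound independent
    -- of `b`.
    (bound := fun z => Real.exp (-‖z‖ ^ 2) *
      (2 * (∑ i, ‖d i‖) * ‖z‖ + 2 * (|a| + 1) * (∑ i, ‖d i‖) ^ 2))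
    (Metric.ball_mem_nhds a one_pos) ?_ (integrable_log_partition d a) ?_ ?_
    (integrable_gaussian_mul_affine _ _) ?_).2
  · refine Eventually.of_forall fun b => (integrable_log_partition d b).aestronglyMeasurable
  · exact Continuous.aestronglyMeasurable (by fun_prop)
  · refine ae_of_all _ fun z b hb => ?_
    rw [norm_mul, Real.norm_of_nonneg (Real.exp_pos _).le]
    refine mul_le_mul_of_nonneg_left ?_ (Real.exp_pos _).le
    refine (abs_deriv_log_partition_le d b z).trans ?_
    have hb' : |b| ≤ |a| + 1 := by
      rw [Metric.mem_ball, Real.dist_eq] at hb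
      have := abs_sub_abs_le_abs_sub b a
      linarith
    gcongr
  · refine ae_of_all _ fun z b _ => (hasDerivAt_log_partition d b z).const_mul _

theorem norm_postMean_le : ‖postMean d a z‖ ≤ ∑ i, ‖d i‖ := by
  refine (norm_sum_le _ _).trans (Finset.sum_le_sum fun k _ => ?_)
  rw [norm_smul, Real.norm_of_nonneg (posterior_pos d a z k).le]
  exact mul_le_of_le_one_left (norm_nonneg _) (posterior_le_one d a z k)

/-- The logarithmic gradient of a normalized weight is that of the weight, `-2 a d k`, minus its
posterior average. -/
theorem hasFDerivAt_posterior (k : ι) :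
    HasFDerivAt (fun z => posterior d a z k)
      ((-2 * a * posterior d a z k) • innerSL ℝ (d k - postMean d a z)) z := by
  have hZ : HasFDerivAt (fun z => partition d a z)
      (∑ k, (-2 * a * tilt d a z k) • innerSL ℝ (d k)) z := by
    unfold partition
    exact HasFDerivAt.fun_sum fun k _ => hasFDerivAt_tilt d a z k
  have hne := (partition_pos d a z).ne'
  refine (((hasFDerivAt_tilt d a z k).mul ((hasDerivAt_inv hne).comp_hasFDerivAt z hZ)).congr_fderiv
    ?_).congr_of_eventuallyEq (Eventually.of_forall fun w => div_eq_mul_inv _ _)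
  ext v
  have hm : inner ℝ (postMean d a z) v =
      (∑ i, tilt d a z i * inner ℝ (d i) v) / partition d a z := by
    rw [postMean, sum_inner, Finset.sum_div]
    refine Finset.sum_congr rfl fun i _ => ?_
    rw [real_inner_smul_left, posterior]; ring
  have hs : ∑ i, (-2 * a * tilt d a z i) * inner ℝ (d i) v =
      -2 * a * (partition d a z * inner ℝ (postMean d a z) v) := by
    rw [hm, mul_div_cancel₀ _ hne, Finset.mul_sum]
    exact Finset.sum_congr rfl fun i _ => by ring
  simp only [smul_apply, add_apply, sum_apply, innerSL_apply_apply, smul_eq_mul, inner_sub_left,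
    posterior, Function.comp_apply]
  rw [hs]
  field_simp
  ring

/-- Gaussian integration by parts for a posterior probability. -/
theorem integral_gaussian_mul_posterior_mul_inner (k : ι) :
    2 * ∫ z : ℂ, Real.exp (-‖z‖ ^ 2) * (posterior d a z k * inner ℝ z (d k)) =
      ∫ z : ℂ, Real.exp (-‖z‖ ^ 2) *
        (-2 * a * posterior d a z k * inner ℝ (d k - postMean d a z) (d k)) := by
  have hg : ∀ z, fderiv ℝ (fun z : ℂ => Real.exp (-‖z‖ ^ 2)) z (d k) =
      Real.exp (-‖z‖ ^ 2) * (-2 * inner ℝ z (d k)) := fun z => by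
    rw [(hasFDerivAt_gaussian z).fderiv]
    simp; ring
  have hp : ∀ z, fderiv ℝ (fun z => posterior d a z k) z (d k) =
      -2 * a * posterior d a z k * inner ℝ (d k - postMean d a z) (d k) := fun z => by
    rw [(hasFDerivAt_posterior d a z k).fderiv, smul_apply,
      innerSL_apply_apply, smul_eq_mul]
  have hbp : ∀ z, |posterior d a z k| ≤ 1 := fun z => by
    rw [abs_of_pos (posterior_pos d a z k)]; exact posterior_le_one d a z k
  have hi1 : Integrable (fun z : ℂ => Real.exp (-‖z‖ ^ 2) *
      ((-2 * inner ℝ z (d k)) * posterior d a z k)) := by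
    refine integrable_gaussian_mul_of_bound (by fun_prop) (2 * ‖d k‖) 0 fun z => ?_
    rw [abs_mul, abs_mul, show |(-2 : ℝ)| = 2 by norm_num]
    have h1 := abs_real_inner_le_norm z (d k)
    have h2 := mul_le_mul (mul_le_mul_of_nonneg_left h1 zero_le_two) (hbp z) (abs_nonneg _)
      (by positivity)
    linarith
  have hi2 : Integrable (fun z : ℂ => Real.exp (-‖z‖ ^ 2) *
      (-2 * a * posterior d a z k * inner ℝ (d k - postMean d a z) (d k))) := by
    refine integrable_gaussian_mul_of_bound (by fun_prop) 0
      (2 * |a| * ((‖d k‖ + ∑ i, ‖d i‖) * ‖d k‖)) fun z => ?_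
    rw [abs_mul, abs_mul, abs_mul, show |(-2 : ℝ)| = 2 by norm_num, zero_mul, zero_add]
    have h1 := abs_real_inner_le_norm (d k - postMean d a z) (d k)
    have h2 : ‖d k - postMean d a z‖ ≤ ‖d k‖ + ∑ i, ‖d i‖ :=
      (norm_sub_le _ _).trans (by linarith [norm_postMean_le d a z])
    have h3 := h1.trans (mul_le_mul_of_nonneg_right h2 (norm_nonneg (d k)))
    have h4 : 2 * |a| * |posterior d a z k| ≤ 2 * |a| :=
      mul_le_of_le_one_right (by positivity) (hbp z)
    exact mul_le_mul h4 h3 (abs_nonneg _) (by positivity)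
  have hi3 : Integrable (fun z : ℂ => Real.exp (-‖z‖ ^ 2) * posterior d a z k) :=
    integrable_gaussian_mul_of_bound (by fun_prop) 0 1 fun z => by
      simpa using hbp z
  have hibp := integral_mul_fderiv_eq_neg_fderiv_mul_of_integrable (μ := (volume : Measure ℂ))
    (f := fun z : ℂ => Real.exp (-‖z‖ ^ 2)) (g := fun z => posterior d a z k) (v := d k)
    (by simpa only [hg, mul_assoc] using hi1) (by simpa only [hp] using hi2) hi3
    (fun z _ => (hasFDerivAt_gaussian z).differentiableAt)
    (fun z _ => (hasFDerivAt_posterior d a z k).differentiableAt)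
  simp only [hg, hp] at hibp
  rw [hibp, ← integral_neg, ← integral_const_mul]
  refine integral_congr_ae (ae_of_all _ fun z => ?_)
  ring

/-- With `m` the posterior mean, integration by parts replaces `-2⟨z, d k⟩` by `2a(‖d k‖² - ⟨m, d
k⟩)`. The terms `‖d k‖²` cancel, and the posterior average of `⟨m, d k⟩` is `‖m‖²`. -/
theorem hasDerivAt_logPartition :
    HasDerivAt (logPartition d)
      (-(2 * a) * ∫ z : ℂ, Real.exp (-‖z‖ ^ 2) * ‖postMean d a z‖ ^ 2) a := by
  refine (hasDerivAt_logPartition_integral d a).congr_deriv ?_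
  set D := ∑ i, ‖d i‖
  have hbp : ∀ z k, |posterior d a z k| ≤ 1 := fun z k => by
    rw [abs_of_pos (posterior_pos d a z k)]; exact posterior_le_one d a z k
  have hi1 : ∀ k, Integrable (fun z : ℂ => Real.exp (-‖z‖ ^ 2) *
      (posterior d a z k * inner ℝ z (d k))) := fun k => by
    refine integrable_gaussian_mul_of_bound (by fun_prop) ‖d k‖ 0 fun z => ?_
    rw [abs_mul]
    have h1 := abs_real_inner_le_norm z (d k)
    have h2 := mul_le_mul (hbp z k) h1 (abs_nonneg _) zero_le_one
    linarith
  have hi2 : ∀ k, Integrable (fun z : ℂ => Real.exp (-‖z‖ ^ 2) * posterior d a z k) := fun k =>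
    integrable_gaussian_mul_of_bound (by fun_prop) 0 1 fun z => by simpa using hbp z k
  have hi3 : ∀ k, Integrable (fun z : ℂ => Real.exp (-‖z‖ ^ 2) *
      (posterior d a z k * inner ℝ (postMean d a z) (d k))) := fun k => by
    refine integrable_gaussian_mul_of_bound (by fun_prop) 0 (D * ‖d k‖) fun z => ?_
    rw [abs_mul, zero_mul, zero_add]
    have h1 := (abs_real_inner_le_norm (postMean d a z) (d k)).trans
      (mul_le_mul_of_nonneg_right (norm_postMean_le d a z) (norm_nonneg (d k)))
    have h2 := mul_le_mul (hbp z k) h1 (abs_nonneg _) zero_le_one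
    linarith
  have hterm : ∀ k, ∫ z : ℂ, Real.exp (-‖z‖ ^ 2) *
      (posterior d a z k * (-2 * inner ℝ z (d k) - 2 * a * ‖d k‖ ^ 2)) =
      ∫ z : ℂ, -(2 * a) * (Real.exp (-‖z‖ ^ 2) *
        (posterior d a z k * inner ℝ (postMean d a z) (d k))) := fun k => by
    have e1 : ∫ z : ℂ, Real.exp (-‖z‖ ^ 2) *
        (posterior d a z k * (-2 * inner ℝ z (d k) - 2 * a * ‖d k‖ ^ 2)) =
        -(2 * ∫ z : ℂ, Real.exp (-‖z‖ ^ 2) * (posterior d a z k * inner ℝ z (d k))) -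
          2 * a * ‖d k‖ ^ 2 * ∫ z : ℂ, Real.exp (-‖z‖ ^ 2) * posterior d a z k := by
      rw [← integral_const_mul, ← integral_const_mul, ← integral_neg,
        ← integral_sub (((hi1 k).const_mul 2).fun_neg) ((hi2 k).const_mul _)]
      refine integral_congr_ae (ae_of_all _ fun z => ?_)
      simp only
      ring
    have e2 : ∫ z : ℂ, Real.exp (-‖z‖ ^ 2) *
        (-2 * a * posterior d a z k * inner ℝ (d k - postMean d a z) (d k)) =
        -(2 * a * ‖d k‖ ^ 2 * ∫ z : ℂ, Real.exp (-‖z‖ ^ 2) * posterior d a z k) -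
        ∫ z : ℂ, -(2 * a) * (Real.exp (-‖z‖ ^ 2) *
        (posterior d a z k * inner ℝ (postMean d a z) (d k))) := by
      rw [← integral_const_mul, ← integral_neg,
        ← integral_sub ((hi2 k).const_mul _).fun_neg ((hi3 k).const_mul _)]
      refine integral_congr_ae (ae_of_all _ fun z => ?_)
      simp only [inner_sub_left, real_inner_self_eq_norm_sq]
      ring
    rw [e1, integral_gaussian_mul_posterior_mul_inner, e2]
    ring
  have hi4 : ∀ k, Integrable (fun z : ℂ => Real.exp (-‖z‖ ^ 2) *
      (posterior d a z k * (-2 * inner ℝ z (d k) - 2 * a * ‖d k‖ ^ 2))) := fun k => by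
    refine (((hi1 k).const_mul (-2)).sub ((hi2 k).const_mul (2 * a * ‖d k‖ ^ 2))).congr
      (ae_of_all _ fun z => ?_)
    simp only [Pi.sub_apply]
    ring
  simp only [Finset.mul_sum]
  rw [integral_finsetSum _ fun k _ => hi4 k, Finset.sum_congr rfl fun k _ => hterm k,
    ← integral_finsetSum _ fun k _ => (hi3 k).const_mul _, ← integral_const_mul]
  refine integral_congr_ae (ae_of_all _ fun z => ?_)
  simp only
  rw [← Finset.mul_sum, ← Finset.mul_sum]
  congr 2
  have h : ∀ w, inner ℝ w (postMean d a z) = ∑ k, posterior d a z k * inner ℝ w (d k) := fun w => by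
    rw [postMean, inner_sum]
    exact Finset.sum_congr rfl fun k _ => real_inner_smul_right _ _ _
  rw [← h, real_inner_self_eq_norm_sq]

/-- Split off the weight 1 of the zero displacement, apply `log (1 + x) ≤ √x`, and use subadditivity
of the root so that each remaining tilt is integrated separately. -/
theorem logPartition_le [DecidableEq ι] {j : ι} (hj : d j = 0) :
    logPartition d a ≤
      ∑ k ∈ Finset.univ.erase j, Real.pi * Real.exp (-(a ^ 2 * ‖d k‖ ^ 2 / 4)) := by
  have hpt : ∀ z : ℂ, Real.exp (-‖z‖ ^ 2) * Real.log (partition d a z) ≤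
      ∑ k ∈ Finset.univ.erase j, Real.exp (-‖z‖ ^ 2) * √(tilt d a z k) := fun z => by
    rw [← Finset.mul_sum]
    refine mul_le_mul_of_nonneg_left ?_ (Real.exp_pos _).le
    have h1 : partition d a z = 1 + ∑ k ∈ Finset.univ.erase j, tilt d a z k := by
      rw [partition, ← Finset.add_sum_erase _ _ (Finset.mem_univ j)]
      simp [tilt, hj]
    rw [h1]
    exact (log_one_add_le_sqrt (Finset.sum_nonneg fun k _ => (tilt_pos d a z k).le)).trans
      (sqrt_sum_le_sum_sqrt _ fun k _ => (tilt_pos d a z k).le)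
  refine (integral_mono (integrable_log_partition d a)
    (integrable_finsetSum _ fun k _ => (integral_gaussian_mul_sqrt_tilt d a k).1) hpt).trans ?_
  rw [integral_finsetSum _ fun k _ => (integral_gaussian_mul_sqrt_tilt d a k).1]
  exact (Finset.sum_congr rfl fun k _ => (integral_gaussian_mul_sqrt_tilt d a k).2).le

theorem integrable_gaussian_mul_norm_postMean_sq :
    Integrable (fun z : ℂ => Real.exp (-‖z‖ ^ 2) * ‖postMean d a z‖ ^ 2) :=
  integrable_gaussian_mul_of_bound (by fun_prop) 0 ((∑ i, ‖d i‖) ^ 2) fun z => by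
    rw [abs_of_nonneg (sq_nonneg _), zero_mul, zero_add]
    exact pow_le_pow_left₀ (norm_nonneg _) (norm_postMean_le d a z) 2

end Nonempty

end

noncomputable section

open MeasureTheory

/-! ### Mutual information and minimum mean square error -/

namespace Constellation

variable {M : ℕ} (S : Constellation M)

/-- The displacements of the constellation as seen from the symbol `j`. -/
def disp (j k : Fin M) : ℂ := S.sym j - S.sym k

theorem disp_self (j : Fin M) : S.disp j j = 0 := sub_self _

/-- Recentring at the transmitted point makes the Gaussian weight common to all symbols; they then
enter only through their displacements from `sym j`. -/
theorem kernel_add (γ : ℝ) (j k : Fin M) (z : ℂ) :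
    S.kernel γ k (z + (√γ : ℂ) * S.sym j) =
      Real.exp (-‖z‖ ^ 2) * tilt (S.disp j) √γ z k := by
  rw [gaussian_mul_tilt, kernel, disp]
  ring_nf

theorem sum_kernel_add (γ : ℝ) (j : Fin M) (z : ℂ) :
    ∑ k, S.kernel γ k (z + (√γ : ℂ) * S.sym j) =
      Real.exp (-‖z‖ ^ 2) * partition (S.disp j) √γ z := by
  simp only [kernel_add, partition, Finset.mul_sum]

theorem kernel_self_add (γ : ℝ) (j : Fin M) (z : ℂ) :
    S.kernel γ j (z + (√γ : ℂ) * S.sym j) = Real.exp (-‖z‖ ^ 2) := by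
  simp [kernel]

theorem pos {M : ℕ} (S : Constellation M) : 0 < M := by
  rcases Nat.eq_zero_or_pos M with rfl | h
  · simpa using S.unit_energy
  · exact h

section NeZero

variable [NeZero M]

theorem integral_kernel_mul_logb (γ : ℝ) (j : Fin M) :
    ∫ u : ℂ, S.kernel γ j u * Real.logb 2 (∑ k, S.kernel γ k u) =
      (logPartition (S.disp j) √γ - Real.pi) / Real.log 2 := by
  rw [← integral_add_right_eq_self _ ((√γ : ℂ) * S.sym j)]
  simp only [kernel_self_add, sum_kernel_add]
  have h : ∀ z : ℂ, Real.exp (-‖z‖ ^ 2) *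
      Real.logb 2 (Real.exp (-‖z‖ ^ 2) * partition (S.disp j) √γ z) =
      (Real.exp (-‖z‖ ^ 2) * Real.log (partition (S.disp j) √γ z) -
        ‖z‖ ^ 2 * Real.exp (-‖z‖ ^ 2)) / Real.log 2 := fun z => by
    rw [Real.logb, Real.log_mul (Real.exp_pos _).ne' (partition_pos _ _ _).ne', Real.log_exp]
    ring
  simp only [h]
  rw [integral_div, integral_sub (integrable_log_partition _ _) integrable_norm_sq_mul_gaussian,
    integral_norm_sq_mul_gaussian, logPartition]

/-- The logarithm of the common Gaussian factor integrates to `-π`, which cancels the `1 / e` inside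
the first term of `info`. -/
theorem info_eq (γ : ℝ) :
    S.info γ = (Real.log M - 1 / (M * Real.pi) * ∑ j, logPartition (S.disp j) √γ) /
      Real.log 2 := by
  have hM : (M : ℝ) ≠ 0 := NeZero.ne _
  rw [info, ell]
  simp only [integral_kernel_mul_logb]
  rw [Real.logb, Real.log_div hM (Real.exp_pos 1).ne', Real.log_exp, ← Finset.sum_div,
    Finset.sum_sub_distrib]
  simp only [Finset.sum_const, Finset.card_univ, Fintype.card_fin, nsmul_eq_mul]
  field_simp
  ring

/-- This identifies the posterior mean displacement with the estimation error when `sym j` is sent.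
-/
theorem condMean_add (γ : ℝ) (j : Fin M) (z : ℂ) :
    S.condMean γ (z + (√γ : ℂ) * S.sym j) = S.sym j - postMean (S.disp j) √γ z := by
  have hZ : ((partition (S.disp j) √γ z : ℝ) : ℂ) ≠ 0 := by
    exact_mod_cast (partition_pos _ _ _).ne'
  have hE : ((Real.exp (-‖z‖ ^ 2) : ℝ) : ℂ) ≠ 0 := by exact_mod_cast (Real.exp_pos _).ne'
  have hp : postMean (S.disp j) √γ z = S.sym j -
      (∑ k, (tilt (S.disp j) √γ z k : ℂ) * S.sym k) / (partition (S.disp j) √γ z : ℂ) := by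
    have h1 : ∑ k, (posterior (S.disp j) √γ z k : ℂ) = 1 := by
      exact_mod_cast sum_posterior (S.disp j) √γ z
    simp only [postMean, disp, Complex.real_smul, mul_sub, Finset.sum_sub_distrib]
    change ∑ k, (posterior (S.disp j) √γ z k : ℂ) * _ - ∑ k, (posterior (S.disp j) √γ z k : ℂ) * _ = _
    rw [← Finset.sum_mul, h1, one_mul, Finset.sum_div]
    congr 1
    refine Finset.sum_congr rfl fun k _ => ?_
    rw [posterior]; push_cast; ring
  rw [hp, condMean, sub_sub_cancel, ← Complex.ofReal_sum, sum_kernel_add]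
  simp only [kernel_add, Complex.ofReal_mul, mul_assoc]
  rw [← Finset.mul_sum, mul_div_mul_left _ _ hE]

theorem mmse_eq (γ : ℝ) :
    S.mmse γ = 1 / (M * Real.pi) * ∑ j, ∫ z : ℂ,
      Real.exp (-‖z‖ ^ 2) * ‖postMean (S.disp j) √γ z‖ ^ 2 := by
  rw [mmse]
  congr 1
  refine Finset.sum_congr rfl fun j _ => ?_
  rw [← integral_add_right_eq_self _ ((√γ : ℂ) * S.sym j)]
  simp only [kernel_self_add, condMean_add, sub_sub_cancel]

theorem continuous_info : Continuous S.info := by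
  have h : Continuous fun γ => (Real.log M - 1 / (M * Real.pi) *
      ∑ j, logPartition (S.disp j) √γ) / Real.log 2 := by
    have hc : ∀ j, Continuous (logPartition (S.disp j)) := fun j =>
      continuous_iff_continuousAt.2 fun a => (hasDerivAt_logPartition (S.disp j) a).continuousAt
    have hc' : ∀ j, Continuous fun γ : ℝ => logPartition (S.disp j) √γ := fun j =>
      (hc j).comp Real.continuous_sqrt
    fun_prop
  exact h.congr fun γ => (S.info_eq γ).symm

/-- The relation between mutual information and minimum mean square error. -/
theorem hasDerivAt_info {γ : ℝ} (hγ : 0 < γ) :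
    HasDerivAt S.info (S.mmse γ / Real.log 2) γ := by
  have hs : HasDerivAt (fun γ => ∑ j, logPartition (S.disp j) √γ)
      (∑ j, (-(2 * √γ) * ∫ z : ℂ, Real.exp (-‖z‖ ^ 2) * ‖postMean (S.disp j) √γ z‖ ^ 2) *
        (1 / (2 * √γ))) γ :=
    -- The factor `2 * √γ` of the derivative in the amplitude cancels against the derivative of the
    -- root, which exists only away from 0.
    HasDerivAt.fun_sum fun j _ => (hasDerivAt_logPartition (S.disp j) √γ).comp γ
      (Real.hasDerivAt_sqrt hγ.ne')
  have h := (((hs.const_mul (1 / (M * Real.pi))).const_sub (Real.log M)).div_const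
    (Real.log 2)).congr_of_eventuallyEq (Eventually.of_forall fun γ => S.info_eq γ)
  refine h.congr_deriv ?_
  rw [mmse_eq, ← mul_neg, ← Finset.sum_neg_distrib]
  congr 2
  refine Finset.sum_congr rfl fun j _ => ?_
  have := (Real.sqrt_pos.2 hγ).ne'
  field_simp

theorem info_zero : S.info 0 = 0 := by
  have hM : (M : ℝ) ≠ 0 := NeZero.ne _
  simp only [info_eq, Real.sqrt_zero, logPartition_zero]
  simp only [Finset.sum_const, Finset.card_univ, Fintype.card_fin, nsmul_eq_mul]
  rw [div_eq_zero_iff]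
  left
  field_simp
  ring

/-- Since `Real.sqrt` is 0 on negative numbers, `info` is defined and constant there; outage events
can thus be described on the whole line. -/
theorem info_of_nonpos {γ : ℝ} (hγ : γ ≤ 0) : S.info γ = 0 := by
  rw [← S.info_zero, info_eq, info_eq, Real.sqrt_eq_zero_of_nonpos hγ, Real.sqrt_zero]

theorem info_le (γ : ℝ) : S.info γ ≤ Real.logb 2 M := by
  rw [info_eq, Real.logb]
  have h : 0 ≤ ∑ j, logPartition (S.disp j) √γ :=
    Finset.sum_nonneg fun j _ => logPartition_nonneg _ _ (S.disp_self j)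
  have h2 : 0 ≤ 1 / (M * Real.pi) * ∑ j, logPartition (S.disp j) √γ := by positivity
  have := Real.log_pos one_lt_two
  gcongr
  linarith

/-- The mutual information approaches its supremum exponentially fast. -/
theorem exists_sub_info_le :
    ∃ C κ : ℝ, 0 < C ∧ 0 < κ ∧ ∀ γ, 0 ≤ γ →
      Real.logb 2 M - S.info γ ≤ C * Real.exp (-(κ * γ)) := by
  have hM : (0 : ℝ) < M := by exact_mod_cast S.pos
  have hl := Real.log_pos one_lt_two
  -- `κ` bounds the quarter squared distances from below. Taking it close to 0 avoids a minimum over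
  -- pairs, of which there are none if `M = 1`.
  obtain ⟨κ, hκ0, hκ⟩ : ∃ κ : ℝ, 0 < κ ∧ ∀ j k, j ≠ k → κ ≤ ‖S.disp j k‖ ^ 2 / 4 := by
    have h : ∀ᶠ κ : ℝ in 𝓝[>] 0, ∀ j k, j ≠ k → κ ≤ ‖S.disp j k‖ ^ 2 / 4 := by
      refine eventually_all.2 fun j => eventually_all.2 fun k => ?_
      by_cases hjk : j = k
      · exact Eventually.of_forall fun _ h => absurd hjk h
      · have h1 : 0 < ‖S.disp j k‖ ^ 2 / 4 := by
          have : S.disp j k ≠ 0 := sub_ne_zero.2 fun h => hjk (S.injective h)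
          positivity
        filter_upwards [Ioo_mem_nhdsGT h1] with κ hκ _ using hκ.2.le
    obtain ⟨κ, h1, h2⟩ := (h.and self_mem_nhdsWithin).exists
    exact ⟨κ, h2, h1⟩
  refine ⟨M / Real.log 2, κ, by positivity, hκ0, fun γ hγ => ?_⟩
  have hj : ∀ j, logPartition (S.disp j) √γ ≤ M * (Real.pi * Real.exp (-(κ * γ))) := fun j => by
    refine (logPartition_le (S.disp j) √γ (S.disp_self j)).trans ?_
    calc ∑ k ∈ Finset.univ.erase j, Real.pi * Real.exp (-(√γ ^ 2 * ‖S.disp j k‖ ^ 2 / 4))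
        ≤ ∑ k ∈ Finset.univ.erase j, Real.pi * Real.exp (-(κ * γ)) := by
          refine Finset.sum_le_sum fun k hk => ?_
          refine mul_le_mul_of_nonneg_left (Real.exp_le_exp.2 ?_) Real.pi_pos.le
          rw [Real.sq_sqrt hγ]
          have := mul_le_mul_of_nonneg_left (hκ j k (Finset.ne_of_mem_erase hk).symm) hγ
          linarith
      _ ≤ ∑ k : Fin M, Real.pi * Real.exp (-(κ * γ)) :=
          Finset.sum_le_sum_of_subset_of_nonneg (Finset.erase_subset _ _) fun _ _ _ => by positivity
      _ = _ := by simp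
  have hsum : ∑ j, logPartition (S.disp j) √γ ≤ M * (M * (Real.pi * Real.exp (-(κ * γ)))) := by
    refine (Finset.sum_le_sum fun j _ => hj j).trans ?_
    simp
  rw [info_eq, Real.logb]
  have h2 : 1 / (M * Real.pi) * ∑ j, logPartition (S.disp j) √γ ≤ M * Real.exp (-(κ * γ)) := by
    refine (mul_le_mul_of_nonneg_left hsum (by positivity)).trans_eq ?_
    field_simp
  calc _ = (1 / (M * Real.pi) * ∑ j, logPartition (S.disp j) √γ) / Real.log 2 := by ring
    _ ≤ (M * Real.exp (-(κ * γ))) / Real.log 2 := by gcongr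
    _ = _ := by ring

theorem tendsto_info : Tendsto S.info atTop (𝓝 (Real.logb 2 M)) := by
  obtain ⟨C, κ, -, hκ, h⟩ := S.exists_sub_info_le
  have h1 : Tendsto (fun γ : ℝ => Real.logb 2 M - C * Real.exp (-(κ * γ))) atTop
      (𝓝 (Real.logb 2 M - C * 0)) :=
    ((Real.tendsto_exp_neg_atTop_nhds_zero.comp (tendsto_id.const_mul_atTop hκ)).const_mul
      C).const_sub _
  rw [mul_zero, sub_zero] at h1
  refine tendsto_of_tendsto_of_tendsto_of_le_of_le' h1 tendsto_const_nhds ?_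
    (Eventually.of_forall S.info_le)
  filter_upwards [eventually_ge_atTop 0] with γ hγ
  linarith [h γ hγ]

/-- A continuous nonnegative integrand with zero integral vanishes identically. At the received
value 0 this would make every symbol equal to the one conditional mean, against injectivity. -/
theorem mmse_pos (hM : 1 < M) (γ : ℝ) : 0 < S.mmse γ := by
  have hM0 : (0 : ℝ) < M := by exact_mod_cast S.pos
  have hnn : ∀ j, 0 ≤ fun z : ℂ => Real.exp (-‖z‖ ^ 2) * ‖postMean (S.disp j) √γ z‖ ^ 2 :=
    fun j z => by positivity
  have hne : ∃ j, S.sym j ≠ S.condMean γ 0 := by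
    by_contra! h
    have h1 := S.injective ((h ⟨0, by omega⟩).trans (h ⟨1, hM⟩).symm)
    simp at h1
  obtain ⟨j, hj⟩ := hne
  rw [mmse_eq]
  refine mul_pos (by positivity) (Finset.sum_pos' (fun i _ => integral_nonneg (hnn i))
    ⟨j, Finset.mem_univ j, ?_⟩)
  have hc : Continuous fun z : ℂ => Real.exp (-‖z‖ ^ 2) * ‖postMean (S.disp j) √γ z‖ ^ 2 := by
    fun_prop
  refine (integral_nonneg (hnn j)).lt_of_ne' fun h0 => hj ?_
  rw [integral_eq_zero_iff_of_nonneg (hnn j) (integrable_gaussian_mul_norm_postMean_sq _ _),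
    hc.ae_eq_iff_eq volume continuous_zero] at h0
  -- This noise value cancels the transmitted signal, so that 0 is received.
  have h1 := congrFun h0 (-((√γ : ℂ) * S.sym j))
  have h2 := S.condMean_add γ j (-((√γ : ℂ) * S.sym j))
  rw [neg_add_cancel] at h2
  rw [h2]
  have h3 : postMean (S.disp j) √γ (-((√γ : ℂ) * S.sym j)) = 0 := by
    simpa [(Real.exp_pos _).ne'] using h1
  rw [h3, sub_zero]

end NeZero

end Constellation

end

noncomputable section

open MeasureTheory Set

/-! ### The inverse of the mutual information -/

namespace Constellation

variable {M : ℕ} [NeZero M] (S : Constellation M) (hM : 1 < M)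

include hM

theorem deriv_info_pos {γ : ℝ} : 0 < S.mmse γ / Real.log 2 :=
  div_pos (S.mmse_pos hM γ) (Real.log_pos one_lt_two)

theorem strictMonoOn_info : StrictMonoOn S.info (Ici 0) := by
  refine strictMonoOn_of_deriv_pos (convex_Ici 0) S.continuous_info.continuousOn fun x hx => ?_
  rw [interior_Ici] at hx
  rw [(S.hasDerivAt_info hx).deriv]
  exact S.deriv_info_pos hM

theorem info_lt (γ : ℝ) : S.info γ < Real.logb 2 M := by
  rcases le_total γ 0 with h | h
  · rw [S.info_of_nonpos h]
    exact Real.logb_pos one_lt_two (by exact_mod_cast hM)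
  · exact (S.strictMonoOn_info hM h (mem_Ici.2 (by linarith)) (lt_add_one γ)).trans_le
      (S.info_le _)

theorem info_nonneg (γ : ℝ) : 0 ≤ S.info γ := by
  rcases le_total γ 0 with h | h
  · rw [S.info_of_nonpos h]
  · rw [← S.info_zero]
    exact (S.strictMonoOn_info hM).monotoneOn self_mem_Ici h h

theorem bijOn_info : BijOn S.info (Ici 0) (Ico 0 (Real.logb 2 M)) := by
  refine ⟨fun x _ => ⟨S.info_nonneg hM x, S.info_lt hM x⟩, (S.strictMonoOn_info hM).injOn, ?_⟩
  rintro r ⟨h0, h1⟩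
  obtain ⟨b, hb0, hb⟩ :=
    ((eventually_ge_atTop 0).and (S.tendsto_info.eventually (lt_mem_nhds h1))).exists
  obtain ⟨x, hx, rfl⟩ := intermediate_value_Icc hb0 S.continuous_info.continuousOn
    ⟨S.info_zero.trans_le h0, hb.le⟩
  exact ⟨x, hx.1, rfl⟩

theorem infoInv_nonneg {r : ℝ} (hr : r ∈ Ico 0 (Real.logb 2 M)) : 0 ≤ S.infoInv r :=
  Function.invFunOn_mem ((S.bijOn_info hM).surjOn hr)

theorem info_infoInv {r : ℝ} (hr : r ∈ Ico 0 (Real.logb 2 M)) : S.info (S.infoInv r) = r :=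
  Function.invFunOn_eq ((S.bijOn_info hM).surjOn hr)

theorem infoInv_info {x : ℝ} (hx : 0 ≤ x) : S.infoInv (S.info x) = x :=
  (S.bijOn_info hM).injOn
    (S.infoInv_nonneg hM ⟨S.info_nonneg hM x, S.info_lt hM x⟩) hx
    (S.info_infoInv hM ⟨S.info_nonneg hM x, S.info_lt hM x⟩)

theorem lt_infoInv_iff {r x : ℝ} (hr : r ∈ Ico 0 (Real.logb 2 M)) (hx : 0 ≤ x) :
    x < S.infoInv r ↔ S.info x < r := by
  rw [← (S.strictMonoOn_info hM).lt_iff_lt hx (S.infoInv_nonneg hM hr), S.info_infoInv hM hr]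

theorem infoInv_lt_iff {r x : ℝ} (hr : r ∈ Ico 0 (Real.logb 2 M)) (hx : 0 ≤ x) :
    S.infoInv r < x ↔ r < S.info x := by
  rw [← (S.strictMonoOn_info hM).lt_iff_lt (S.infoInv_nonneg hM hr) hx, S.info_infoInv hM hr]

theorem strictMonoOn_infoInv : StrictMonoOn S.infoInv (Ico 0 (Real.logb 2 M)) := by
  intro r hr t ht hrt
  rwa [S.lt_infoInv_iff hM ht (S.infoInv_nonneg hM hr), S.info_infoInv hM hr]

theorem infoInv_pos {r : ℝ} (hr : r ∈ Ioo 0 (Real.logb 2 M)) : 0 < S.infoInv r := by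
  rw [S.lt_infoInv_iff hM ⟨hr.1.le, hr.2⟩ le_rfl, S.info_zero]
  exact hr.1

theorem continuousAt_infoInv {r : ℝ} (hr : r ∈ Ioo 0 (Real.logb 2 M)) :
    ContinuousAt S.infoInv r := by
  refine ((S.strictMonoOn_infoInv hM).mono Ioo_subset_Ico_self).continuousAt_of_image_mem_nhds
    (Ioo_mem_nhds hr.1 hr.2) (mem_of_superset (Ioi_mem_nhds (S.infoInv_pos hM hr)) ?_)
  intro x hx
  refine ⟨S.info x, ⟨?_, S.info_lt hM x⟩, S.infoInv_info hM (le_of_lt hx)⟩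
  rw [← S.info_zero]
  exact S.strictMonoOn_info hM self_mem_Ici (mem_Ici.2 (le_of_lt hx)) hx

theorem hasDerivAt_infoInv {r : ℝ} (hr : r ∈ Ioo 0 (Real.logb 2 M)) :
    HasDerivAt S.infoInv (S.mmse (S.infoInv r) / Real.log 2)⁻¹ r := by
  refine HasDerivAt.of_local_left_inverse (S.continuousAt_infoInv hM hr)
    (S.hasDerivAt_info (S.infoInv_pos hM hr)) (S.deriv_info_pos hM).ne' ?_
  filter_upwards [Ioo_mem_nhds hr.1 hr.2] with t ht using S.info_infoInv hM ⟨ht.1.le, ht.2⟩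

/-- A linear lower bound for the increments of the mutual information below a positive point. -/
theorem exists_mul_le_info_sub {H : ℝ} (hH : 0 < H) :
    ∃ c, 0 < c ∧ ∀ y ∈ Ico 0 H, c * (H - y) ≤ S.info H - S.info y := by
  have hd := S.hasDerivAt_info hH
  -- `dslope` extends the difference quotient continuously to `y = H` by the positive derivative, so
  -- it has a positive minimum on `[0, H]`.
  have hc : ContinuousOn (dslope S.info H) (Icc 0 H) :=
    ((continuousOn_dslope univ_mem).2
      ⟨S.continuous_info.continuousOn, hd.differentiableAt⟩).mono (subset_univ _)
  have hslope : ∀ y ∈ Ico 0 H, dslope S.info H y = (S.info H - S.info y) / (H - y) :=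
    fun y hy => by
      rw [dslope_of_ne _ hy.2.ne, slope_def_field, ← neg_sub, ← neg_sub H y, neg_div_neg_eq]
  have hpos : ∀ y ∈ Icc 0 H, 0 < dslope S.info H y := fun y hy => by
    rcases hy.2.eq_or_lt with rfl | h
    · rw [dslope_same, hd.deriv]
      exact S.deriv_info_pos hM
    · rw [hslope y ⟨hy.1, h⟩]
      exact div_pos (sub_pos.2 (S.strictMonoOn_info hM hy.1 hH.le h)) (sub_pos.2 h)
  obtain ⟨y₀, hy₀, hmin⟩ := isCompact_Icc.exists_isMinOn ⟨0, left_mem_Icc.2 hH.le⟩ hc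
  refine ⟨_, hpos y₀ hy₀, fun y hy => ?_⟩
  have h := hmin (Ico_subset_Icc_self hy)
  rw [mem_ofPred_eq, hslope y hy] at h
  rwa [le_div_iff₀ (sub_pos.2 hy.2)] at h

/-! ### Shifts of the mutual information by the target rate -/

section Rate

variable {R : ℝ} (hR : 0 < R) (hRM : R < Real.logb 2 M)

include hR hRM

theorem snrH_pos : 0 < snrH S R := S.infoInv_pos hM ⟨by linarith, by linarith⟩

theorem info_snrH : S.info (snrH S R) = Real.logb 2 M - R :=
  S.info_infoInv hM ⟨by linarith, by linarith⟩

theorem rate_add_info_mem {y : ℝ} (hy : y ∈ Ico 0 (snrH S R)) :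
    R + S.info y ∈ Ioo 0 (Real.logb 2 M) := by
  have h1 := S.info_nonneg hM y
  have h2 := S.strictMonoOn_info hM hy.1 (S.snrH_pos hM hR hRM).le hy.2
  rw [S.info_snrH hM hR hRM] at h2
  constructor <;> linarith

theorem snrF_pos {y : ℝ} (hy : y ∈ Ico 0 (snrH S R)) : 0 < snrF S R y :=
  S.infoInv_pos hM (S.rate_add_info_mem hM hR hRM hy)

theorem info_snrF {y : ℝ} (hy : y ∈ Ico 0 (snrH S R)) :
    S.info (snrF S R y) = R + S.info y :=
  S.info_infoInv hM (Ioo_subset_Ico_self (S.rate_add_info_mem hM hR hRM hy))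

theorem continuousOn_snrF : ContinuousOn (snrF S R) (Ico 0 (snrH S R)) := fun _ hy =>
  ContinuousAt.continuousWithinAt <|
    ContinuousAt.comp (S.continuousAt_infoInv hM (S.rate_add_info_mem hM hR hRM hy))
      (S.continuous_info.continuousAt.const_add R)

theorem info_sub_rate_mem {x : ℝ} (hx : S.infoInv R < x) :
    S.info x - R ∈ Ioo 0 (Real.logb 2 M) := by
  have h0 := (S.infoInv_pos hM ⟨hR, hRM⟩).trans hx
  have h1 := S.info_lt hM x
  rw [S.infoInv_lt_iff hM ⟨hR.le, hRM⟩ h0.le] at hx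
  constructor <;> linarith

theorem info_snrZ {x : ℝ} (hx : S.infoInv R < x) : S.info (snrZ S R x) = S.info x - R :=
  S.info_infoInv hM (Ioo_subset_Ico_self (S.info_sub_rate_mem hM hR hRM hx))

theorem snrZ_mem {x : ℝ} (hx : S.infoInv R < x) : snrZ S R x ∈ Ioo 0 (snrH S R) := by
  have h := S.info_sub_rate_mem hM hR hRM hx
  refine ⟨S.infoInv_pos hM h, S.strictMonoOn_infoInv hM (Ioo_subset_Ico_self h)
    ⟨by linarith, by linarith⟩ ?_⟩
  linarith [S.info_lt hM x]

theorem snrF_snrZ {x : ℝ} (hx : S.infoInv R < x) : snrF S R (snrZ S R x) = x := by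
  rw [snrF, S.info_snrZ hM hR hRM hx, add_sub_cancel,
    S.infoInv_info hM ((S.infoInv_pos hM ⟨hR, hRM⟩).trans hx).le]

theorem infoInv_lt_snrF {y : ℝ} (hy : y ∈ Ioo 0 (snrH S R)) : S.infoInv R < snrF S R y := by
  have hy' := Ioo_subset_Ico_self hy
  rw [S.infoInv_lt_iff hM ⟨hR.le, hRM⟩ (S.snrF_pos hM hR hRM hy').le,
    S.info_snrF hM hR hRM hy']
  have := S.strictMonoOn_info hM self_mem_Ici (mem_Ici.2 hy.1.le) hy.1
  rw [S.info_zero] at this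
  linarith

theorem snrZ_snrF {y : ℝ} (hy : y ∈ Ioo 0 (snrH S R)) : snrZ S R (snrF S R y) = y := by
  rw [snrZ, S.info_snrF hM hR hRM (Ioo_subset_Ico_self hy), add_sub_cancel_left,
    S.infoInv_info hM hy.1.le]

theorem image_snrZ : snrZ S R '' Ioi (S.infoInv R) = Ioo 0 (snrH S R) := by
  ext y
  constructor
  · rintro ⟨x, hx, rfl⟩
    exact S.snrZ_mem hM hR hRM hx
  · intro hy
    exact ⟨_, S.infoInv_lt_snrF hM hR hRM hy, S.snrZ_snrF hM hR hRM hy⟩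

theorem injOn_snrZ : InjOn (snrZ S R) (Ioi (S.infoInv R)) := fun x hx y hy h => by
  rw [← S.snrF_snrZ hM hR hRM hx, h, S.snrF_snrZ hM hR hRM hy]

theorem hasDerivAt_snrZ {x : ℝ} (hx : S.infoInv R < x) :
    HasDerivAt (snrZ S R) (S.mmse x / S.mmse (snrZ S R x)) x := by
  have h0 := (S.infoInv_pos hM ⟨hR, hRM⟩).trans hx
  have h := (S.hasDerivAt_infoInv hM (S.info_sub_rate_mem hM hR hRM hx)).comp x
    ((S.hasDerivAt_info h0).sub_const R)
  refine h.congr_deriv ?_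
  have := (Real.log_pos one_lt_two).ne'
  have := (S.mmse_pos hM (snrZ S R x)).ne'
  rw [snrZ] at *
  field_simp

/-- Powers of `snrF` have at most an inverse square root singularity at `snrH`. -/
theorem exists_snrF_rpow_le {lam : ℝ} (hlam : 0 < lam) :
    ∃ C, 0 < C ∧ ∀ y ∈ Ico 0 (snrH S R),
      snrF S R y ^ lam ≤ C * (snrH S R - y) ^ (-(1 / 2) : ℝ) := by
  obtain ⟨C, κ, hC, hκ, hdecay⟩ := S.exists_sub_info_le
  obtain ⟨c, hc, hlin⟩ := S.exists_mul_le_info_sub hM (S.snrH_pos hM hR hRM)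
  -- Chosen so that `exp (q x) ^ lam = exp (κ x) ^ (1/2)`; the exponent `1/2` matters only in being
  -- less than 1, for integrability.
  set q := κ / 2 / lam with hq
  have hq0 : 0 < q := by positivity
  refine ⟨q⁻¹ ^ lam * (C / c) ^ (1 / 2 : ℝ), by positivity, fun y hy => ?_⟩
  set x := snrF S R y with hx
  have hx0 : 0 < x := S.snrF_pos hM hR hRM hy
  have hHy : 0 < snrH S R - y := sub_pos.2 hy.2
  -- Both bounds concern one quantity: `info H - info y = logb 2 M - info x`, because `info H = logb
  -- 2 M - R` and `info x = R + info y`.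
  have h1 : c * (snrH S R - y) ≤ C * Real.exp (-(κ * x)) := by
    have h2 := hdecay x hx0.le
    rw [S.info_snrF hM hR hRM hy] at h2
    have h3 := hlin y hy
    rw [S.info_snrH hM hR hRM] at h3
    linarith
  have h2 : Real.exp (κ * x) ≤ C / c * (snrH S R - y)⁻¹ := by
    rw [Real.exp_neg, ← div_eq_mul_inv, le_div_iff₀ (Real.exp_pos _)] at h1
    rw [← div_eq_mul_inv, div_div, le_div_iff₀ (by positivity)]
    linarith
  have h3 : q * x ≤ Real.exp (q * x) := by linarith [Real.add_one_le_exp (q * x)]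
  calc x ^ lam = q⁻¹ ^ lam * (q * x) ^ lam := by
        rw [← Real.mul_rpow (by positivity) (by positivity), inv_mul_cancel_left₀ hq0.ne']
    _ ≤ q⁻¹ ^ lam * Real.exp (q * x) ^ lam := by gcongr
    _ = q⁻¹ ^ lam * Real.exp (κ * x) ^ (1 / 2 : ℝ) := by
        rw [← Real.exp_mul, ← Real.exp_mul]
        congr 2
        rw [hq]
        field_simp
    _ ≤ q⁻¹ ^ lam * (C / c * (snrH S R - y)⁻¹) ^ (1 / 2 : ℝ) := by gcongr
    _ = _ := by
        rw [Real.mul_rpow (by positivity) (by positivity), Real.rpow_neg hHy.le,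
          Real.inv_rpow hHy.le, mul_assoc]

end Rate

end Constellation

end

noncomputable section

open MeasureTheory Set

/-! ### Mixture Gamma distributions -/

theorem integrableOn_rpow_mul_exp_neg_mul {b r : ℝ} (hb : 0 < b) (hr : 0 < r) :
    IntegrableOn (fun x : ℝ => x ^ (b - 1) * Real.exp (-(r * x))) (Ioi 0) := by
  refine Integrable.of_integral_ne_zero ?_
  rw [Real.integral_rpow_mul_exp_neg_mul_Ioi hb hr]
  exact (mul_pos (Real.rpow_pos_of_pos (by positivity) _) (Real.Gamma_pos_of_pos hb)).ne'

theorem intervalIntegrable_rpow_mul_exp {b : ℝ} (hb : 0 < b) (r x y : ℝ) :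
    IntervalIntegrable (fun t : ℝ => t ^ (b - 1) * Real.exp (-(r * t))) volume x y :=
  (intervalIntegral.intervalIntegrable_rpow' (by linarith)).mul_continuousOn (by fun_prop)

theorem rpow_neg_mul_lowerGamma {b r x : ℝ} (hr : 0 < r) (hx : 0 ≤ x) :
    r ^ (-b) * lowerGamma b (r * x) =
      ∫ t in (0 : ℝ)..x, t ^ (b - 1) * Real.exp (-(r * t)) := by
  have h := intervalIntegral.mul_integral_comp_mul_left (a := 0) (b := x)
    (f := fun t : ℝ => t ^ (b - 1) * Real.exp (-t)) r
  rw [mul_zero] at h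
  rw [lowerGamma, ← h, ← mul_assoc, ← intervalIntegral.integral_const_mul]
  refine intervalIntegral.integral_congr fun t ht => ?_
  rw [uIcc_of_le hx] at ht
  rw [Real.mul_rpow hr.le ht.1, ← mul_assoc, ← mul_assoc]
  congr 2
  rw [Real.rpow_sub_one hr.ne', Real.rpow_neg hr.le]
  have := (Real.rpow_pos_of_pos hr b).ne'
  field_simp

/-- Elementary bounds for the incomplete Gamma integral near the origin. -/
theorem integral_rpow_mul_exp_bounds {b r x : ℝ} (hb : 0 < b) (hr : 0 ≤ r) (hx : 0 ≤ x) :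
    Real.exp (-(r * x)) * (x ^ b / b) ≤ ∫ t in (0 : ℝ)..x, t ^ (b - 1) * Real.exp (-(r * t)) ∧
      ∫ t in (0 : ℝ)..x, t ^ (b - 1) * Real.exp (-(r * t)) ≤ x ^ b / b := by
  have hI : ∫ t in (0 : ℝ)..x, t ^ (b - 1) = x ^ b / b := by
    rw [integral_rpow (Or.inl (by linarith)), sub_add_cancel, Real.zero_rpow hb.ne', sub_zero]
  have hi : IntervalIntegrable (fun t : ℝ => t ^ (b - 1)) volume 0 x :=
    intervalIntegral.intervalIntegrable_rpow' (by linarith)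
  have hi' := intervalIntegrable_rpow_mul_exp hb r 0 x
  constructor
  · rw [← hI, ← intervalIntegral.integral_const_mul]
    refine intervalIntegral.integral_mono_on hx (hi.const_mul _) hi' fun t ht => ?_
    rw [mul_comm]
    refine mul_le_mul_of_nonneg_left (Real.exp_le_exp.2 ?_) (Real.rpow_nonneg ht.1 _)
    linarith [mul_le_mul_of_nonneg_left ht.2 hr]
  · rw [← hI]
    refine intervalIntegral.integral_mono_on hx hi' hi fun t ht => ?_
    refine mul_le_of_le_one_right (Real.rpow_nonneg ht.1 _) (Real.exp_le_one_iff.2 ?_)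
    linarith [mul_nonneg hr ht.1]

namespace MixtureGamma

variable {L : ℕ} (D : MixtureGamma L)

theorem pdf_nonneg {x : ℝ} (hx : 0 ≤ x) : 0 ≤ D.pdf x :=
  Finset.sum_nonneg fun l _ =>
    mul_nonneg (mul_nonneg (D.α_nonneg l) (Real.rpow_nonneg hx _)) (Real.exp_pos _).le

theorem pdf_pos {x : ℝ} (hx : 0 < x) : 0 < D.pdf x := by
  -- Total mass one excludes that all coefficients vanish.
  obtain ⟨l, hl⟩ : ∃ l, 0 < D.α l := by
    by_contra! h
    have h0 : ∀ l, D.α l = 0 := fun l => le_antisymm (h l) (D.α_nonneg l)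
    have := D.total
    simp [h0] at this
  refine Finset.sum_pos' (fun l _ => ?_) ⟨l, Finset.mem_univ l, ?_⟩
  · exact mul_nonneg (mul_nonneg (D.α_nonneg l) (Real.rpow_nonneg hx.le _)) (Real.exp_pos _).le
  · exact mul_pos (mul_pos hl (Real.rpow_pos_of_pos hx _)) (Real.exp_pos _)

theorem measurable_pdf : Measurable D.pdf := by
  unfold pdf; fun_prop

theorem continuousOn_pdf : ContinuousOn D.pdf (Ioi 0) := by
  unfold pdf
  refine continuousOn_finsetSum _ fun l _ => ?_
  refine (continuousOn_const.mul (continuousOn_id.rpow_const fun x hx => Or.inl ?_)).mul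
    (by fun_prop)
  exact (ne_of_gt hx : x ≠ 0)

theorem integrableOn_pdf : IntegrableOn D.pdf (Ioi 0) := by
  unfold pdf
  refine integrable_finsetSum _ fun l _ => ?_
  simpa only [mul_assoc] using
    (integrableOn_rpow_mul_exp_neg_mul (D.β_pos l) (D.ζ_pos l)).const_mul (D.α l)

theorem integral_pdf : ∫ x in Ioi 0, D.pdf x = 1 := by
  rw [← D.total]
  simp only [pdf, mul_assoc]
  rw [integral_finsetSum _ fun l _ =>
    (integrableOn_rpow_mul_exp_neg_mul (D.β_pos l) (D.ζ_pos l)).const_mul (D.α l)]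
  refine Finset.sum_congr rfl fun l _ => ?_
  rw [integral_const_mul, Real.integral_rpow_mul_exp_neg_mul_Ioi (D.β_pos l) (D.ζ_pos l),
    one_div, Real.inv_rpow (D.ζ_pos l).le, Real.rpow_neg (D.ζ_pos l).le,
    mul_comm (Real.Gamma _)]

theorem cdf_eq_sum {x : ℝ} (hx : 0 ≤ x) :
    D.cdf x = ∑ l, D.α l * ∫ t in (0 : ℝ)..x, t ^ (D.β l - 1) * Real.exp (-(D.ζ l * t)) := by
  refine Finset.sum_congr rfl fun l _ => ?_
  rw [mul_assoc, rpow_neg_mul_lowerGamma (D.ζ_pos l) hx]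

theorem cdf_eq_integral {x : ℝ} (hx : 0 ≤ x) : D.cdf x = ∫ t in Ioc 0 x, D.pdf t := by
  rw [← intervalIntegral.integral_of_le hx, D.cdf_eq_sum hx]
  simp only [pdf, mul_assoc]
  rw [intervalIntegral.integral_finsetSum fun l _ =>
    (intervalIntegrable_rpow_mul_exp (D.β_pos l) (D.ζ l) 0 x).const_mul (D.α l)]
  exact Finset.sum_congr rfl fun l _ => (intervalIntegral.integral_const_mul _ _).symm

theorem one_sub_cdf {x : ℝ} (hx : 0 ≤ x) : 1 - D.cdf x = ∫ t in Ioi x, D.pdf t := by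
  rw [D.cdf_eq_integral hx, ← D.integral_pdf, ← Ioc_union_Ioi_eq_Ioi hx,
    setIntegral_union (Ioc_disjoint_Ioi le_rfl) measurableSet_Ioi
      (D.integrableOn_pdf.mono_set Ioc_subset_Ioi_self)
      (D.integrableOn_pdf.mono_set (Ioi_subset_Ioi hx)), add_sub_cancel_left]

theorem one_sub_cdf_pos {x : ℝ} (hx : 0 ≤ x) : 0 < 1 - D.cdf x := by
  rw [D.one_sub_cdf hx, setIntegral_pos_iff_support_of_nonneg_ae]
  · have h : Ioi x ⊆ Function.support D.pdf ∩ Ioi x := fun t ht =>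
      ⟨(D.pdf_pos (hx.trans_lt ht)).ne', ht⟩
    exact (by simp : (0 : ENNReal) < volume (Ioi x)).trans_le (measure_mono h)
  · filter_upwards [ae_restrict_mem measurableSet_Ioi] with t ht
    exact D.pdf_nonneg (hx.trans (le_of_lt ht))
  · exact D.integrableOn_pdf.mono_set (Ioi_subset_Ioi hx)

/-- Bounds of the distribution function by its leading-order form. -/
theorem cdf_bounds {x : ℝ} (hx : 0 ≤ x) :
    Real.exp (-((∑ l, D.ζ l) * x)) * ∑ l, D.α l / D.β l * x ^ D.β l ≤ D.cdf x ∧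
      D.cdf x ≤ ∑ l, D.α l / D.β l * x ^ D.β l := by
  rw [D.cdf_eq_sum hx, Finset.mul_sum]
  constructor
  · refine Finset.sum_le_sum fun l _ => ?_
    have h1 := (integral_rpow_mul_exp_bounds (D.β_pos l) (D.ζ_pos l).le hx).1
    -- Replacing each rate by the sum of the rates gives one exponential factor for all components.
    have h2 : D.ζ l ≤ ∑ i, D.ζ i :=
      Finset.single_le_sum (fun i _ => (D.ζ_pos i).le) (Finset.mem_univ l)
    have h3 : Real.exp (-((∑ l, D.ζ l) * x)) ≤ Real.exp (-(D.ζ l * x)) :=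
      Real.exp_le_exp.2 (by linarith [mul_le_mul_of_nonneg_right h2 hx])
    have h4 : 0 ≤ x ^ D.β l / D.β l := div_nonneg (Real.rpow_nonneg hx _) (D.β_pos l).le
    calc _ = D.α l * (Real.exp (-((∑ l, D.ζ l) * x)) * (x ^ D.β l / D.β l)) := by ring
      _ ≤ _ := mul_le_mul_of_nonneg_left
        ((mul_le_mul_of_nonneg_right h3 h4).trans h1) (D.α_nonneg l)
  · refine Finset.sum_le_sum fun l _ => ?_
    have h1 := (integral_rpow_mul_exp_bounds (D.β_pos l) (D.ζ_pos l).le hx).2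
    calc _ ≤ D.α l * (x ^ D.β l / D.β l) := mul_le_mul_of_nonneg_left h1 (D.α_nonneg l)
      _ = _ := by ring

theorem law_real_apply {A : Set ℝ} (hA : MeasurableSet A) :
    D.law.real A = ∫ x in A ∩ Ioi 0, D.pdf x := by
  have hae : (A ∩ Ici 0 : Set ℝ) =ᵐ[volume] (A ∩ Ioi 0 : Set ℝ) :=
    (ae_eq_refl A).inter Ioi_ae_eq_Ici.symm
  rw [measureReal_def, law, withDensity_apply _ hA, Measure.restrict_restrict hA,
    Measure.restrict_congr_set hae, integral_eq_lintegral_of_nonneg_ae]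
  · filter_upwards [ae_restrict_mem (hA.inter measurableSet_Ioi)] with t ht
    exact D.pdf_nonneg (le_of_lt ht.2)
  · exact D.measurable_pdf.aestronglyMeasurable

theorem isFiniteMeasure_law : IsFiniteMeasure D.law := by
  refine isFiniteMeasure_withDensity_ofReal ?_
  have h : IntegrableOn D.pdf (Ici 0) := (integrableOn_Ici_iff_integrableOn_Ioi).2 D.integrableOn_pdf
  exact h.2

theorem law_real_univ : D.law.real univ = 1 := by
  rw [D.law_real_apply MeasurableSet.univ, univ_inter, D.integral_pdf]

theorem law_real_Iio {x : ℝ} (hx : 0 ≤ x) : D.law.real (Iio x) = D.cdf x := by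
  rw [D.law_real_apply measurableSet_Iio, D.cdf_eq_integral hx, Iio_inter_Ioi,
    integral_Ioc_eq_integral_Ioo]

theorem integral_law (f : ℝ → ℝ) : ∫ y, f y ∂D.law = ∫ y in Ioi 0, D.pdf y * f y := by
  rw [law, integral_withDensity_eq_integral_toReal_smul (by have := D.measurable_pdf; fun_prop)
    (ae_of_all _ fun _ => ENNReal.ofReal_lt_top), integral_Ici_eq_integral_Ioi]
  refine setIntegral_congr_fun measurableSet_Ioi fun y hy => ?_
  simp only [smul_eq_mul]
  rw [ENNReal.toReal_ofReal (D.pdf_nonneg (le_of_lt hy))]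

end MixtureGamma

end

noncomputable section

open MeasureTheory Set

/-! ### The coefficients and the outage probability -/

section Rate

variable {M LE : ℕ} [NeZero M] (S : Constellation M) (E : MixtureGamma LE) (hM : 1 < M)
  {R : ℝ} (hR : 0 < R) (hRM : R < Real.logb 2 M)

theorem integrableOn_sub_rpow_neg_half (H : ℝ) :
    IntegrableOn (fun y : ℝ => (H - y) ^ (-(1 / 2) : ℝ)) (Ioo 0 H) := by
  rcases le_or_gt H 0 with h | h
  · simp [Ioo_eq_empty_of_le h]
  · have h1 : IntervalIntegrable (fun y : ℝ => y ^ (-(1 / 2) : ℝ)) volume H 0 :=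
      intervalIntegral.intervalIntegrable_rpow' (by norm_num)
    have h2 := h1.comp_sub_left H
    rw [sub_self, sub_zero, intervalIntegrable_iff_integrableOn_Ioo_of_le h.le] at h2
    exact h2

include hM hR hRM

/-- The two singularities lie at opposite ends. Below `H / 2` the density may blow up at 0 but is
integrable, and the power of `snrF` is bounded; above `H / 2` the density is bounded and the power
is controlled by `(H - y)^(-1/2)`. -/
theorem integrableOn_snrF_rpow_mul_pdf {lam : ℝ} (hlam : 0 < lam) :
    IntegrableOn (fun y => snrF S R y ^ lam * E.pdf y) (Ioo 0 (snrH S R)) := by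
  obtain ⟨C, hC, hbound⟩ := S.exists_snrF_rpow_le hM hR hRM hlam
  have hH := S.snrH_pos hM hR hRM
  set H := snrH S R
  obtain ⟨P, hP⟩ := (isCompact_Icc (a := H / 2) (b := H)).exists_bound_of_continuousOn
    (E.continuousOn_pdf.mono fun x hx => (half_pos hH).trans_le hx.1)
  have hmeas : ContinuousOn (fun y => snrF S R y ^ lam * E.pdf y) (Ioo 0 H) := by
    refine ContinuousOn.mul ?_ (E.continuousOn_pdf.mono Ioo_subset_Ioi_self)
    exact ((S.continuousOn_snrF hM hR hRM).mono Ioo_subset_Ico_self).rpow_const fun _ _ =>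
      Or.inr hlam.le
  have hint : IntegrableOn (fun y => C * ((H / 2) ^ (-(1 / 2) : ℝ) * E.pdf y +
      |P| * (H - y) ^ (-(1 / 2) : ℝ))) (Ioo 0 H) :=
    (((E.integrableOn_pdf.mono_set Ioo_subset_Ioi_self).const_mul _).add
      ((integrableOn_sub_rpow_neg_half H).const_mul _)).const_mul C
  refine hint.mono' (hmeas.aestronglyMeasurable measurableSet_Ioo) ?_
  filter_upwards [ae_restrict_mem measurableSet_Ioo] with y hy
  have hF : 0 ≤ snrF S R y ^ lam :=
    Real.rpow_nonneg (S.snrF_pos hM hR hRM (Ioo_subset_Ico_self hy)).le _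
  have hpdf := E.pdf_nonneg hy.1.le
  have hHy : 0 < H - y := sub_pos.2 hy.2
  have hs : 0 ≤ (H - y) ^ (-(1 / 2) : ℝ) := Real.rpow_nonneg hHy.le _
  rw [Real.norm_of_nonneg (mul_nonneg hF hpdf)]
  refine (mul_le_mul_of_nonneg_right (hbound y (Ioo_subset_Ico_self hy)) hpdf).trans ?_
  rw [mul_assoc]
  refine mul_le_mul_of_nonneg_left ?_ hC.le
  rcases le_total y (H / 2) with h | h
  · have h1 : (H - y) ^ (-(1 / 2) : ℝ) ≤ (H / 2) ^ (-(1 / 2) : ℝ) :=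
      Real.rpow_le_rpow_of_nonpos (half_pos hH) (by linarith) (by norm_num)
    have h2 := mul_le_mul_of_nonneg_right h1 hpdf
    have h3 := mul_nonneg (abs_nonneg P) hs
    linarith
  · have h1 : E.pdf y ≤ |P| :=
      (le_abs_self _).trans ((hP y ⟨h, hy.2.le⟩).trans (le_abs_self P))
    have h2 := mul_le_mul_of_nonneg_left h1 hs
    have h3 : 0 ≤ (H / 2) ^ (-(1 / 2) : ℝ) * E.pdf y :=
      mul_nonneg (Real.rpow_nonneg (half_pos hH).le _) hpdf
    linarith

theorem coeffDelta_pos {lam : ℝ} (hlam : 0 < lam) : 0 < coeffDelta S E R lam := by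
  have hpos : ∀ y ∈ Ioo 0 (snrH S R), 0 < snrF S R y ^ lam * E.pdf y := fun y hy =>
    mul_pos (Real.rpow_pos_of_pos (S.snrF_pos hM hR hRM (Ioo_subset_Ico_self hy)) _)
      (E.pdf_pos hy.1)
  rw [coeffDelta, setIntegral_pos_iff_support_of_nonneg_ae]
  · have h : Ioo 0 (snrH S R) ⊆
        Function.support (fun y => snrF S R y ^ lam * E.pdf y) ∩ Ioo 0 (snrH S R) := fun y hy =>
      ⟨(hpos y hy).ne', hy⟩
    refine lt_of_lt_of_le ?_ (measure_mono h)
    simpa using S.snrH_pos hM hR hRM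
  · filter_upwards [ae_restrict_mem measurableSet_Ioo] with y hy using (hpos y hy).le
  · exact integrableOn_snrF_rpow_mul_pdf S E hM hR hRM hlam

/-- Change of variables `y = snrZ x` from `(infoInv R, ∞)` onto `(0, snrH)`: there `snrF (snrZ x) =
x`, and the ratio of the MMSEs in `funW` is the Jacobian. Integrability is carried over by the same
substitution. -/
theorem hasMellin_funK {lam : ℝ} (hlam : 0 < lam) :
    HasMellin (fun x => (funK S E R x : ℂ)) ((lam : ℂ) + 1) (coeffDelta S E R lam : ℂ) := by
  have hX := S.infoInv_pos hM ⟨hR, hRM⟩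
  have hd : ∀ x ∈ Ioi (S.infoInv R), HasDerivWithinAt (snrZ S R)
      (S.mmse x / S.mmse (snrZ S R x)) (Ioi (S.infoInv R)) x := fun x hx =>
    (S.hasDerivAt_snrZ hM hR hRM hx).hasDerivWithinAt
  have hfun : ∀ x, x ^ lam * funK S E R x = (Ioi (S.infoInv R)).indicator (fun x =>
      |S.mmse x / S.mmse (snrZ S R x)| •
        (snrF S R (snrZ S R x) ^ lam * E.pdf (snrZ S R x))) x := fun x => by
    by_cases hx : x ≤ S.infoInv R
    · rw [funK, if_pos hx, indicator_of_notMem (by simpa using hx), mul_zero]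
    · have hx' : S.infoInv R < x := not_le.1 hx
      rw [funK, if_neg hx, indicator_of_mem (show x ∈ Ioi (S.infoInv R) from hx'),
        S.snrF_snrZ hM hR hRM hx', funW,
        abs_of_pos (div_pos (S.mmse_pos hM _) (S.mmse_pos hM _)), smul_eq_mul]
      ring
  have hsub : Ioi 0 ∩ Ioi (S.infoInv R) = Ioi (S.infoInv R) :=
    inter_eq_right.2 (Ioi_subset_Ioi hX.le)
  have hint : IntegrableOn (fun x => x ^ lam * funK S E R x) (Ioi 0) := by
    simp only [hfun]
    rw [IntegrableOn, integrable_indicator_iff measurableSet_Ioi, IntegrableOn,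
      Measure.restrict_restrict measurableSet_Ioi, inter_comm, hsub]
    refine (integrableOn_image_iff_integrableOn_abs_deriv_smul measurableSet_Ioi hd
      (S.injOn_snrZ hM hR hRM) (fun y => snrF S R y ^ lam * E.pdf y)).1 ?_
    rw [S.image_snrZ hM hR hRM]
    exact integrableOn_snrF_rpow_mul_pdf S E hM hR hRM hlam
  have heq : ∫ x in Ioi 0, x ^ lam * funK S E R x = coeffDelta S E R lam := by
    simp only [hfun]
    rw [setIntegral_indicator measurableSet_Ioi, hsub, coeffDelta, ← S.image_snrZ hM hR hRM,
      integral_image_eq_integral_abs_deriv_smul measurableSet_Ioi hd (S.injOn_snrZ hM hR hRM)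
      (fun y => snrF S R y ^ lam * E.pdf y)]
  have hcast : EqOn (fun x : ℝ => ((x ^ lam * funK S E R x : ℝ) : ℂ))
      (fun x : ℝ => (x : ℂ) ^ ((lam : ℂ) + 1 - 1) • (funK S E R x : ℂ)) (Ioi 0) := fun x hx => by
    simp only [add_sub_cancel_right, smul_eq_mul]
    rw [Complex.ofReal_mul, Complex.ofReal_cpow (le_of_lt hx)]
  constructor
  · exact IntegrableOn.congr_fun hint.ofReal hcast measurableSet_Ioi
  · rw [mellin, ← setIntegral_congr_fun measurableSet_Ioi hcast, integral_complex_ofReal, heq]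

theorem outage_section_of_lt {y : ℝ} (hy : y ∈ Ico 0 (snrH S R)) :
    {x | secrecyRate S x y < R} = Iio (snrF S R y) := by
  ext x
  have hr := Ioo_subset_Ico_self (S.rate_add_info_mem hM hR hRM hy)
  simp only [mem_ofPred_eq, mem_Iio, secrecyRate, max_lt_iff, hR, and_true, sub_lt_iff_lt_add]
  rcases le_or_gt 0 x with hx | hx
  · rw [snrF, S.lt_infoInv_iff hM hr hx]
  -- Negative `x` carry no information, so both sides hold.
  · refine iff_of_true ?_ (hx.trans (S.snrF_pos hM hR hRM hy))
    rw [S.info_of_nonpos hx.le]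
    linarith [S.info_nonneg hM y]

/-- Here `info y ≥ logb 2 M - R`, and `info x < logb 2 M` for every `x`, so the rate cannot reach
`R`. -/
theorem outage_section_of_le {y : ℝ} (hy : snrH S R ≤ y) :
    {x | secrecyRate S x y < R} = univ := by
  refine eq_univ_of_forall fun x => ?_
  have hH := S.snrH_pos hM hR hRM
  have h1 := (S.strictMonoOn_info hM).monotoneOn hH.le (hH.le.trans hy) hy
  rw [S.info_snrH hM hR hRM] at h1
  have h2 := S.info_lt hM x
  exact max_lt (by linarith) hR

/-- The outage probability splits at the eavesdropper SNR `snrH`, above which outage is certain. -/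
theorem sop_eq {LB : ℕ} (B : MixtureGamma LB) :
    IntegrableOn (fun y => B.cdf (snrF S R y) * E.pdf y) (Ioo 0 (snrH S R)) ∧
    sop S B E R =
      (∫ y in Ioo 0 (snrH S R), B.cdf (snrF S R y) * E.pdf y) + (1 - E.cdf (snrH S R)) := by
  have hH := S.snrH_pos hM hR hRM
  have := B.isFiniteMeasure_law
  have := E.isFiniteMeasure_law
  set s : Set (ℝ × ℝ) := {p | secrecyRate S p.1 p.2 < R} with hs
  have hsm : MeasurableSet s := by
    refine measurableSet_lt ?_ measurable_const
    have := S.continuous_info.measurable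
    unfold secrecyRate
    fun_prop
  set h : ℝ → ℝ := fun y => B.law.real {x | secrecyRate S x y < R} with hh
  have hmeas : Measurable h := (measurable_measure_prodMk_right hsm).ennreal_toReal
  have hle : ∀ y, ‖h y‖ ≤ 1 := fun y => by
    rw [Real.norm_of_nonneg measureReal_nonneg, ← B.law_real_univ]
    exact measureReal_mono (subset_univ _)
  have hint : IntegrableOn (fun y => E.pdf y * h y) (Ioi 0) :=
    E.integrableOn_pdf.mul_bdd hmeas.aestronglyMeasurable (ae_of_all _ hle)
  have hsop : sop S B E R = ∫ y in Ioi 0, E.pdf y * h y := by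
    rw [sop, Measure.prod_apply_symm hsm, ← E.integral_law, ← integral_toReal
      (measurable_measure_prodMk_right hsm).aemeasurable (ae_of_all _ fun y => measure_lt_top _ _)]
    rfl
  have hlow : EqOn (fun y => E.pdf y * h y) (fun y => B.cdf (snrF S R y) * E.pdf y)
      (Ioo 0 (snrH S R)) := fun y hy => by
    have hy' := Ioo_subset_Ico_self hy
    simp only [hh]
    rw [outage_section_of_lt S hM hR hRM hy',
      B.law_real_Iio (S.snrF_pos hM hR hRM hy').le, mul_comm]
  have hhigh : EqOn (fun y => E.pdf y * h y) E.pdf (Ici (snrH S R)) := fun y hy => by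
    simp only [hh]
    rw [outage_section_of_le S hM hR hRM hy, B.law_real_univ, mul_one]
  refine ⟨(hint.mono_set Ioo_subset_Ioi_self).congr_fun hlow measurableSet_Ioo, ?_⟩
  rw [hsop, ← Ioo_union_Ici_eq_Ioi hH, setIntegral_union
    (disjoint_left.2 fun _ hy hy' => not_le_of_gt hy.2 (mem_Ici.1 hy')) measurableSet_Ici
    (hint.mono_set Ioo_subset_Ioi_self) (hint.mono_set (Ici_subset_Ioi.2 hH)),
    setIntegral_congr_fun measurableSet_Ioo hlow, setIntegral_congr_fun measurableSet_Ici hhigh,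
    integral_Ici_eq_integral_Ioi, E.one_sub_cdf hH.le]

end Rate

/-! ### Leading order in the main-channel SNR -/

section Asymptotics

variable {LB : ℕ} [NeZero LB] (B : ℝ → MixtureGamma LB)
  (hζ : ∀ l, Tendsto (fun g => (B g).ζ l) atTop (𝓝 0)) (Φ Λ Ψ : Fin LB → ℝ)
  (hΦ : ∀ l, 0 < Φ l) (hΨ : Monotone Ψ)
  (hB : ∀ g : ℝ, 0 < g → ∀ x : ℝ, 0 < x →
    ∑ l, (B g).α l / (B g).β l * x ^ ((B g).β l) = ∑ l, Φ l * x ^ (Λ l) * g ^ (-(Ψ l)))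

-- The bound does not depend on `g`, because `Ψ 0` is the smallest exponent and `g ≥ 1`; it serves
-- as the dominating function.
include hΦ hΨ hB in
theorem rpow_mul_cdf_mem {g x : ℝ} (hg : 1 ≤ g) (hx : 0 < x) :
    0 ≤ g ^ Ψ 0 * (B g).cdf x ∧ g ^ Ψ 0 * (B g).cdf x ≤ ∑ l, Φ l * x ^ Λ l := by
  have hg0 : 0 < g := one_pos.trans_le hg
  have hb := (B g).cdf_bounds hx.le
  rw [hB g hg0 x hx] at hb
  have h0 : 0 ≤ ∑ l, Φ l * x ^ Λ l * g ^ (-Ψ l) := Finset.sum_nonneg fun l _ => by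
    have := hΦ l; positivity
  refine ⟨mul_nonneg (by positivity) ((mul_nonneg (Real.exp_pos _).le h0).trans hb.1), ?_⟩
  refine (mul_le_mul_of_nonneg_left hb.2 (by positivity)).trans ?_
  rw [Finset.mul_sum]
  refine Finset.sum_le_sum fun l _ => ?_
  have h1 : g ^ Ψ 0 * g ^ (-Ψ l) ≤ 1 := by
    rw [← Real.rpow_add hg0]
    exact Real.rpow_le_one_of_one_le_of_nonpos hg (by linarith [hΨ (Fin.zero_le l)])
  have h2 : 0 ≤ Φ l * x ^ Λ l := by have := hΦ l; positivity
  calc _ = Φ l * x ^ Λ l * (g ^ Ψ 0 * g ^ (-Ψ l)) := by ring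
    _ ≤ _ := mul_le_of_le_one_right h2 h1

-- The two bounds of `cdf_bounds` differ by an exponential factor that tends to 1 as the rates
-- vanish; of the power sum only the terms with `Ψ l = Ψ 0` survive.
include hζ hΨ hB in
theorem tendsto_rpow_mul_cdf {x : ℝ} (hx : 0 < x) :
    Tendsto (fun g => g ^ Ψ 0 * (B g).cdf x) atTop
      (𝓝 (∑ l ∈ Finset.univ.filter (fun l => Ψ l = Ψ 0), Φ l * x ^ Λ l)) := by
  have hA : Tendsto (fun g : ℝ => g ^ Ψ 0 * ∑ l, Φ l * x ^ Λ l * g ^ (-Ψ l)) atTop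
      (𝓝 (∑ l ∈ Finset.univ.filter (fun l => Ψ l = Ψ 0), Φ l * x ^ Λ l)) := by
    have hterm : ∀ l, Tendsto (fun g : ℝ => Φ l * x ^ Λ l * (g ^ Ψ 0 * g ^ (-Ψ l))) atTop
        (𝓝 (if Ψ l = Ψ 0 then Φ l * x ^ Λ l else 0)) := fun l => by
      split_ifs with hl
      · refine tendsto_const_nhds.congr' ?_
        filter_upwards [eventually_gt_atTop 0] with g hg
        rw [← Real.rpow_add hg, hl, add_neg_cancel, Real.rpow_zero, mul_one]
      · have hlt : 0 < Ψ l - Ψ 0 := sub_pos.2 ((hΨ (Fin.zero_le l)).lt_of_ne' hl)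
        have h := (tendsto_rpow_neg_atTop hlt).const_mul (Φ l * x ^ Λ l)
        rw [mul_zero] at h
        refine h.congr' ?_
        filter_upwards [eventually_gt_atTop 0] with g hg
        rw [← Real.rpow_add hg]
        ring_nf
    rw [Finset.sum_filter]
    refine (tendsto_finsetSum _ fun l _ => hterm l).congr fun g => ?_
    rw [Finset.mul_sum]
    exact Finset.sum_congr rfl fun l _ => by ring
  have hexp : Tendsto (fun g => Real.exp (-((∑ l, (B g).ζ l) * x))) atTop (𝓝 1) := by
    have h1 : Tendsto (fun g => -((∑ l, (B g).ζ l) * x)) atTop (𝓝 (-((∑ _l : Fin LB, 0) * x))) :=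
      ((tendsto_finsetSum _ fun l _ => hζ l).mul_const x).neg
    simpa [Function.comp_def] using (Real.continuous_exp.tendsto _).comp h1
  have hlow := hexp.mul hA
  rw [one_mul] at hlow
  refine tendsto_of_tendsto_of_tendsto_of_le_of_le' hlow hA ?_ ?_
  all_goals
    filter_upwards [eventually_gt_atTop 0] with g hg
    have hb := (B g).cdf_bounds hx.le
    rw [hB g hg x hx] at hb
    have hg' : 0 ≤ g ^ Ψ 0 := Real.rpow_nonneg hg.le _
  · calc _ = g ^ Ψ 0 * (Real.exp (-((∑ l, (B g).ζ l) * x)) *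
          ∑ l, Φ l * x ^ Λ l * g ^ (-Ψ l)) := by ring
      _ ≤ _ := mul_le_mul_of_nonneg_left hb.1 hg'
  · exact mul_le_mul_of_nonneg_left hb.2 hg'

variable {M LE : ℕ} [NeZero M] (S : Constellation M) (E : MixtureGamma LE) (hM : 1 < M)
  {R : ℝ} (hR : 0 < R) (hRM : R < Real.logb 2 M) (hΛ : ∀ l, 0 < Λ l)

include hM hR hRM hΛ

include hΦ in
theorem coeffG_pos : 0 < coeffG S E R Φ Λ Ψ :=
  Finset.sum_pos (fun l _ => mul_pos (coeffDelta_pos S E hM hR hRM (hΛ l)) (hΦ l))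
    ⟨0, by simp⟩

include hζ hΦ hΨ hB in
theorem tendsto_rpow_mul_sop_sub :
    Tendsto (fun g => g ^ Ψ 0 * (sop S (B g) E R - (1 - E.cdf (snrH S R)))) atTop
      (𝓝 (coeffG S E R Φ Λ Ψ)) := by
  have hi := fun l => integrableOn_snrF_rpow_mul_pdf S E hM hR hRM (hΛ l)
  have hG : coeffG S E R Φ Λ Ψ = ∫ y in Ioo 0 (snrH S R),
      (∑ l ∈ Finset.univ.filter (fun l => Ψ l = Ψ 0), Φ l * snrF S R y ^ Λ l) * E.pdf y := by
    simp only [Finset.sum_mul, mul_assoc]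
    rw [integral_finsetSum _ fun l _ => (hi l).const_mul (Φ l)]
    refine Finset.sum_congr rfl fun l _ => ?_
    rw [integral_const_mul, coeffDelta, mul_comm]
  have hlhs : ∀ g, g ^ Ψ 0 * (sop S (B g) E R - (1 - E.cdf (snrH S R))) =
      ∫ y in Ioo 0 (snrH S R), g ^ Ψ 0 * ((B g).cdf (snrF S R y) * E.pdf y) := fun g => by
    rw [(sop_eq S E hM hR hRM (B g)).2, add_sub_cancel_right, integral_const_mul]
  simp only [hlhs, hG]
  refine tendsto_integral_filter_of_dominated_convergence
    (fun y => ∑ l, Φ l * (snrF S R y ^ Λ l * E.pdf y)) ?_ ?_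
    (integrable_finsetSum _ fun l _ => (hi l).const_mul (Φ l)) ?_
  · exact Eventually.of_forall fun g =>
      ((sop_eq S E hM hR hRM (B g)).1.const_mul _).aestronglyMeasurable
  · filter_upwards [eventually_ge_atTop 1] with g hg
    filter_upwards [ae_restrict_mem measurableSet_Ioo] with y hy
    have hF := S.snrF_pos hM hR hRM (Ioo_subset_Ico_self hy)
    have h := rpow_mul_cdf_mem B Φ Λ Ψ hΦ hΨ hB hg hF
    have hp := E.pdf_nonneg hy.1.le
    rw [← mul_assoc, Real.norm_of_nonneg (mul_nonneg h.1 hp)]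
    simp only [← mul_assoc]
    rw [← Finset.sum_mul]
    exact mul_le_mul_of_nonneg_right h.2 hp
  · filter_upwards [ae_restrict_mem measurableSet_Ioo] with y hy
    have hF := S.snrF_pos hM hR hRM (Ioo_subset_Ico_self hy)
    simpa only [mul_assoc] using
      (tendsto_rpow_mul_cdf B hζ Φ Λ Ψ hΨ hB hF).mul_const (E.pdf y)

end Asymptotics

/-- A function asymptotic to `G * g ^ (-p)` has decay exponent `p`. -/
theorem tendsto_neg_log_div_log {f : ℝ → ℝ} {G p : ℝ} (hG : 0 < G)
    (hf : Tendsto (fun g => g ^ p * f g) atTop (𝓝 G)) :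
    Tendsto (fun g => -(Real.log (f g) / Real.log g)) atTop (𝓝 p) := by
  have h1 : Tendsto (fun g => p - Real.log (g ^ p * f g) / Real.log g) atTop (𝓝 (p - 0)) :=
    (((Real.continuousAt_log hG.ne').tendsto.comp hf).div_atTop Real.tendsto_log_atTop).const_sub p
  rw [sub_zero] at h1
  refine h1.congr' ?_
  filter_upwards [eventually_gt_atTop 1, hf.eventually (lt_mem_nhds hG)] with g hg hpos
  have hg0 : 0 < g := one_pos.trans hg
  have hgp : 0 < g ^ p := Real.rpow_pos_of_pos hg0 p
  have hfg : 0 < f g := by rwa [mul_pos_iff_of_pos_left hgp] at hpos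
  have hlog := (Real.log_pos hg).ne'
  rw [Real.log_mul hgp.ne' hfg.ne', Real.log_rpow hg0]
  field_simp
  ring

end

end MGSecrecy

theorem theorem3 {M LB LE : ℕ} [NeZero LB]
    (S : Constellation M)
    (R : ℝ) (hR : 0 < R) (hRM : R < Real.logb 2 (M : ℝ))
    (E : MixtureGamma LE)
    (B : ℝ → MixtureGamma LB)
    (hζ : ∀ l, Tendsto (fun g => (B g).ζ l) atTop (𝓝 0))
    (Φ Λ Ψ : Fin LB → ℝ)
    (hΦ : ∀ l, 0 < Φ l) (hΛ : ∀ l, 0 < Λ l) (hΨ₀ : 0 < Ψ 0) (hΨ : Monotone Ψ)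
    (hB : ∀ g : ℝ, 0 < g → ∀ x : ℝ, 0 < x →
      ∑ l, (B g).α l / (B g).β l * x ^ ((B g).β l) = ∑ l, Φ l * x ^ (Λ l) * g ^ (-(Ψ l))) :
    -- the mutual information is an increasing bijection, so that its inverse makes sense
    (StrictMonoOn S.info (Set.Ici 0) ∧
      Set.BijOn S.info (Set.Ici 0) (Set.Ico 0 (Real.logb 2 (M : ℝ)))) ∧
    -- each coefficient is a convergent Mellin transform with a positive value
    (∀ l, HasMellin (fun x => (funK S E R x : ℂ)) ((Λ l : ℂ) + 1)
        (coeffDelta S E R (Λ l) : ℂ) ∧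
      0 < coeffDelta S E R (Λ l)) ∧
    0 < coeffG S E R Φ Λ Ψ ∧
    -- the expansion of the outage probability
    (fun g : ℝ => sop S (B g) E R -
        (1 - E.cdf (snrH S R) + coeffG S E R Φ Λ Ψ * g ^ (-(Ψ 0))))
      =o[atTop] (fun g : ℝ => g ^ (-(Ψ 0))) ∧
    -- a positive limit, approached with diversity order `Ψ 0`
    0 < 1 - E.cdf (snrH S R) ∧
    Tendsto (fun g : ℝ => sop S (B g) E R) atTop (𝓝 (1 - E.cdf (snrH S R))) ∧
    Tendsto (fun g : ℝ =>
        -(Real.log (sop S (B g) E R - (1 - E.cdf (snrH S R))) / Real.log g))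
      atTop (𝓝 (Ψ 0)) := by
  have : NeZero M := ⟨S.pos.ne'⟩
  -- For `M = 1` the interval `0 < R < logb 2 M` is empty.
  have hM : 1 < M := by
    by_contra! h
    have h1 : M = 1 := le_antisymm h S.pos
    subst h1
    simp at hRM
    linarith
  have hG := coeffG_pos Φ Λ Ψ hΦ S E hM hR hRM hΛ
  have hlim := tendsto_rpow_mul_sop_sub B hζ Φ Λ Ψ hΦ hΨ hB S E hM hR hRM hΛ
  refine ⟨⟨S.strictMonoOn_info hM, S.bijOn_info hM⟩,
    fun l => ⟨hasMellin_funK S E hM hR hRM (hΛ l), coeffDelta_pos S E hM hR hRM (hΛ l)⟩, hG, ?_,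
    E.one_sub_cdf_pos (S.snrH_pos hM hR hRM).le, ?_, tendsto_neg_log_div_log hG hlim⟩
  · rw [isLittleO_iff_tendsto']
    · have h := hlim.sub_const (coeffG S E R Φ Λ Ψ)
      rw [sub_self] at h
      refine h.congr' ?_
      filter_upwards [eventually_gt_atTop 0] with g hg
      have hgp := (Real.rpow_pos_of_pos hg (Ψ 0)).ne'
      rw [Real.rpow_neg hg.le]
      field_simp
      ring
    · filter_upwards [eventually_gt_atTop 0] with g hg h0
      exact absurd h0 (Real.rpow_pos_of_pos hg _).ne'
  · have h := (tendsto_rpow_neg_atTop hΨ₀).mul hlim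
    rw [zero_mul] at h
    have h2 := h.add_const (1 - E.cdf (snrH S R))
    rw [zero_add] at h2
    refine h2.congr' ?_
    filter_upwards [eventually_gt_atTop 0] with g hg
    rw [← mul_assoc, ← Real.rpow_add hg, neg_add_cancel, Real.rpow_zero, one_mul, sub_add_cancel]
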